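/- **Notation.** All Hilbert spaces are complex and finite-dimensional, and $\mathbb S(\mathscr H)$ is the unit sphere of $\mathscr H$. A density operator on $\mathscr H$ is a positive operator of trace $1$. For a bounded measurable function $f$ and a measure $\mu$ write $\mu(f)=\int f\,d\mu$, and $\|f\|_\infty=\sup_x|f(x)|$. *GAP measure.* Let $\rho$ be a density operator on $\mathscr H$ with orthonormal eigenbasis $\{\chi_i\}$, $\rho\chi_i=p_i\chi_i$. Let $G(\rho)$ be the law of $\sum_i\sqrt{p_i}\,Z_i\chi_i$, where the $Z_i$ are independent complex Gaussian random variables with mean $0$ and $\mathbb E|Z_i|^2=1$ (independent real and imaginary parts of equal variance). $GAP(\rho)$ is the law on $\mathbb S(\mathscr H)$ of $\phi/\|\phi\|$ when $\phi$ has the distribution $\|\phi\|^2\,G(\rho)(d\phi)$. *Conditional wave function.* For $\psi\in\mathbb S(\mathscr H_1\otimes\mathscr H_2)$ and an orthonormal basis $b=\{b_j\}$ of $\mathscr H_2$, let $\langle b_j|\psi\rangle\in\mathscr H_1$ be the partial inner product and $$\mu_1^{\psi,b}=\sum_j\|\langle b_j|\psi\rangle\|^2\,\delta_{\langle b_j|\psi\rangle/\|\langle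 b_j|\psi\rangle\|}$$ (omitting the terms with $\langle b_j|\psi\rangle=0$), a probability measure on $\mathbb S(\mathscr H_1)$. *Uniform distribution.* For a density operator $\rho_1$ on $\mathscr H_1$, with $\dim\mathscr H_1<\dim\mathscr H_2$, let $\mathscr R(\rho_1)=\{\psi\in\mathbb S(\mathscr H_1\otimes\mathscr H_2):\operatorname{tr}_2|\psi\rangle\langle\psi|=\rho_1\}$. The uniform distribution $u_{\rho_1}$ on $\mathscr R(\rho_1)$ is the law of $\sum_{i}\sqrt{p_i}\,\chi_i\otimes\phi_i$, where $\{\chi_i\}$ is an orthonormal eigenbasis of $\rho_1$ with eigenvalues $p_i$ and $(\phi_i)_{i=1}^{\dim\mathscr H_1}$ is a uniformly distributed orthonormal system in $\mathscr H_2$, i.e. the first $\dim\mathscr H_1$ vectors of an orthonormal basis of $\mathscr H_2$ distributed according to the Haar measure of the unitary group of $\mathscr H_2$. (Neither $G(\rho)$ nor $u_{\rho_1}$ depends on the choice of the eigenbasis.) **Theorem 1.** For every $0<\varepsilon<1$, $0<\delta<1$ and $d_1\in\mathbb N$ there is $D_2=D_2(\varepsilon,\delta,d_1)>0$ such that for all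 $d_2\in\mathbb N$ with $d_2>D_2$ and $d_2>d_1$, for all Hilbert spaces $\mathscr H_1$ and $\mathscr H_2$ with $\dim\mathscr H_1=d_1$ and $\dim\mathscr H_2=d_2$, for every orthonormal basis $b$ of $\mathscr H_2$, for every density operator $\rho_1$ on $\mathscr H_1$, and for every bounded measurable function $f:\mathbb S(\mathscr H_1)\to\mathbb R$ that is not identically zero, $$u_{\rho_1}\Bigl\{\psi\in\mathscr R(\rho_1):\bigl|\mu_1^{\psi,b}(f)-GAP(\rho_1)(f)\bigr|<\varepsilon\,\|f\|_\infty\Bigr\}\ \ge\ 1-\delta .$$ -/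

import Mathlib

open MeasureTheory ProbabilityTheory Module
open scoped TensorProduct NNReal ENNReal

noncomputable section

namespace GAPTypicality

/-! ### Density operators -/

/-- A density operator on a complex (finite-dimensional) Hilbert space: a positive operator
of trace one. -/
structure DensityOperator (H : Type*) [NormedAddCommGroup H] [InnerProductSpace ℂ H] where
  /-- the underlying operator -/
  op : H →ₗ[ℂ] H
  isPositive : op.IsPositive
  trace_eq_one : LinearMap.trace ℂ H op = 1

section Gaussian

variable {H : Type*} [NormedAddCommGroup H] [InnerProductSpace ℂ H] [FiniteDimensional ℂ H]

/-- An orthonormal eigenbasis `χ_i` of `ρ`. -/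
def DensityOperator.eigenbasis (ρ : DensityOperator H) :
    OrthonormalBasis (Fin (finrank ℂ H)) ℂ H :=
  ρ.isPositive.isSymmetric.eigenvectorBasis rfl

/-- The eigenvalues `p_i` of `ρ`, with `ρ χ_i = p_i χ_i`. -/
def DensityOperator.eigenvalue (ρ : DensityOperator H) : Fin (finrank ℂ H) → ℝ :=
  ρ.isPositive.isSymmetric.eigenvalues rfl

/-! ### Gaussian measures and GAP measures -/

/-- The law of a complex Gaussian random variable with mean `0` and variance `E|Z|² = 1`: the real
and imaginary parts are independent real Gaussians with mean `0` and variance `1/2`. -/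
def stdComplexGaussian : Measure ℂ :=
  ((gaussianReal 0 (1 / 2)).prod (gaussianReal 0 (1 / 2))).map
    (fun z : ℝ × ℝ => (⟨z.1, z.2⟩ : ℂ))

/-- The Gaussian measure `G(ρ)` with mean `0` and covariance `ρ`: the law of `∑ i, √p_i Z_i χ_i`
with independent standard complex Gaussians `Z_i`, i.e. the coefficients with respect to an
eigenbasis of `ρ` are independent complex Gaussians with variances `p_i`. -/
def gaussian [MeasurableSpace H] (ρ : DensityOperator H) : Measure H :=
  (Measure.pi fun _ : Fin (finrank ℂ H) => stdComplexGaussian).map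
    (fun z => ∑ i, ((√(ρ.eigenvalue i) : ℂ) * z i) • ρ.eigenbasis i)

end Gaussian

section Project

variable {H : Type*} [NormedAddCommGroup H] [InnerProductSpace ℂ H]

/-- The projection `P ψ = ψ / ‖ψ‖` of nonzero vectors to the unit sphere. -/
def sphereProj (x : ({0}ᶜ : Set H)) : Metric.sphere (0 : H) 1 :=
  ⟨((‖(x : H)‖⁻¹ : ℝ) : ℂ) • (x : H), by
    have hx : ‖(x : H)‖ ≠ 0 := norm_ne_zero_iff.mpr x.2
    simp [norm_smul, hx]⟩

/-- The adjusted measure `A μ (dψ) = ‖ψ‖² μ(dψ)`. -/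
def adjust [MeasurableSpace H] (μ : Measure H) : Measure H :=
  μ.withDensity fun x => ENNReal.ofReal (‖x‖ ^ 2)

/-- The image `P_* μ` on the unit sphere of a measure on `H` that does not charge the origin. -/
def project [MeasurableSpace H] (μ : Measure H) : Measure (Metric.sphere (0 : H) 1) :=
  (μ.comap (Subtype.val : ({0}ᶜ : Set H) → H)).map sphereProj

/-- The measure `GAP(ρ)` on the unit sphere (Gaussian adjusted projected): the law of
`ψ / ‖ψ‖` for `ψ` distributed according to `‖ψ‖² G(ρ)(dψ)`. -/
def GAP [FiniteDimensional ℂ H] [MeasurableSpace H] (ρ : DensityOperator H) :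
    Measure (Metric.sphere (0 : H) 1) :=
  project (adjust (gaussian ρ))

end Project

/-! ### The composite system -/

section Composite

variable {H₁ : Type*} [NormedAddCommGroup H₁] [InnerProductSpace ℂ H₁]
variable {H₂ : Type*} [NormedAddCommGroup H₂] [InnerProductSpace ℂ H₂]

/-- The Hilbert space tensor product carries its Borel σ-algebra. -/
instance tensorMeasurableSpace : MeasurableSpace (H₁ ⊗[ℂ] H₂) := borel _

instance tensorBorelSpace : BorelSpace (H₁ ⊗[ℂ] H₂) := ⟨rfl⟩

/-- The partial inner product `ψ ↦ ⟨φ|ψ⟩ ∈ H₁` with `φ ∈ H₂`, determined by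
`⟨φ| x ⊗ y⟩ = ⟨φ, y⟩ x`. -/
def partialInner (φ : H₂) : H₁ ⊗[ℂ] H₂ →ₗ[ℂ] H₁ :=
  (TensorProduct.rid ℂ H₁).toLinearMap ∘ₗ LinearMap.lTensor H₁ (innerₛₗ ℂ φ)

/-- The partial trace over `H₂`: `tr₂ T = ∑ j, ⟨e_j| T |e_j⟩` with `e` an orthonormal basis
of `H₂`. -/
def partialTrace [FiniteDimensional ℂ H₂] (T : H₁ ⊗[ℂ] H₂ →ₗ[ℂ] H₁ ⊗[ℂ] H₂) : H₁ →ₗ[ℂ] H₁ :=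
  ∑ j, partialInner (stdOrthonormalBasis ℂ H₂ j) ∘ₗ T ∘ₗ
    (TensorProduct.mk ℂ H₁ H₂).flip (stdOrthonormalBasis ℂ H₂ j)

/-- The reduced density matrix `tr₂ |ψ⟩⟨ψ|` of system 1. -/
def reducedDensity [FiniteDimensional ℂ H₂] (ψ : H₁ ⊗[ℂ] H₂) : H₁ →ₗ[ℂ] H₁ :=
  partialTrace (InnerProductSpace.rankOne ℂ ψ ψ).toLinearMap

/-- The set `R(ρ)` of unit vectors in `H₁ ⊗ H₂` with reduced density matrix `ρ`. -/
def statesWithReduced [FiniteDimensional ℂ H₂] (ρ : DensityOperator H₁) : Set (H₁ ⊗[ℂ] H₂) :=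
  {ψ | ‖ψ‖ = 1 ∧ reducedDensity ψ = ρ.op}

open Classical in
/-- The distribution `μ₁^{ψ,b} = ∑ j, ‖⟨b_j|ψ⟩‖² δ_{⟨b_j|ψ⟩ / ‖⟨b_j|ψ⟩‖}` of the conditional wave
function, a measure on the unit sphere of `H₁`; vanishing terms are omitted. -/
def conditionalLaw [MeasurableSpace H₁] {ι : Type*} [Fintype ι] (ψ : H₁ ⊗[ℂ] H₂)
    (b : OrthonormalBasis ι ℂ H₂) : Measure (Metric.sphere (0 : H₁) 1) :=
  ∑ j, if h : partialInner (b j) ψ = 0 then 0 else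
    ENNReal.ofReal (‖partialInner (b j) ψ‖ ^ 2) •
      Measure.dirac (sphereProj ⟨partialInner (b j) ψ, h⟩)

end Composite

/-! ### The uniform distribution on the states with given reduced density matrix -/

section Uniform

variable {H₁ : Type*} [NormedAddCommGroup H₁] [InnerProductSpace ℂ H₁] [FiniteDimensional ℂ H₁]
variable {H₂ : Type*} [NormedAddCommGroup H₂] [InnerProductSpace ℂ H₂] [FiniteDimensional ℂ H₂]
  [CompleteSpace H₂]

/-- The unitary group of a finite-dimensional Hilbert space is compact. -/
instance compactSpace_unitary : CompactSpace (unitary (H₂ →L[ℂ] H₂)) := by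
  have : ProperSpace (H₂ →L[ℂ] H₂) := FiniteDimensional.proper ℂ _
  refine isCompact_iff_compactSpace.mp
    ((isCompact_closedBall (0 : H₂ →L[ℂ] H₂) 1).of_isClosed_subset isClosed_unitary ?_)
  intro U hU
  rcases subsingleton_or_nontrivial (H₂ →L[ℂ] H₂) with h | h
  · simp [Subsingleton.elim U 0]
  · simpa using (CStarRing.norm_of_mem_unitary hU).le

variable (H₂) in
/-- The Haar probability measure on the unitary group of `H₂`. -/
def haarUnitary : Measure (unitary (H₂ →L[ℂ] H₂)) :=
  Measure.haarMeasure ⊤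

variable (H₂) in
/-- The uniform distribution on the orthonormal bases of `H₂`, as a measure on families of
vectors: the law of `(U e_i)_i` for a fixed orthonormal basis `e` and Haar distributed `U`. -/
def uniformONB [MeasurableSpace H₂] : Measure (Fin (finrank ℂ H₂) → H₂) :=
  (haarUnitary H₂).map fun (U : unitary (H₂ →L[ℂ] H₂)) i =>
    (U : H₂ →L[ℂ] H₂) (stdOrthonormalBasis ℂ H₂ i)

variable (H₂) in
/-- The uniform distribution on orthonormal systems of `k ≤ dim H₂` vectors: the law of the first
`k` vectors of a uniformly distributed orthonormal basis. -/
def uniformONS [MeasurableSpace H₂] {k : ℕ} (hk : k ≤ finrank ℂ H₂) : Measure (Fin k → H₂) :=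
  (uniformONB H₂).map fun φ i => φ (Fin.castLE hk i)

/-- The map `(φ_i) ↦ ∑ i, √p_i χ_i ⊗ φ_i`, where `χ_i` is an eigenbasis of `ρ` with eigenvalues
`p_i`. -/
def schmidtMap (ρ : DensityOperator H₁) (φ : Fin (finrank ℂ H₁) → H₂) : H₁ ⊗[ℂ] H₂ :=
  ∑ i, (√(ρ.eigenvalue i) : ℂ) • (ρ.eigenbasis i ⊗ₜ[ℂ] φ i)

/-- The uniform distribution `u_ρ` on `R(ρ)`, as a measure on `H₁ ⊗ H₂`: the image under the
Schmidt map of the uniform distribution on orthonormal systems in `H₂`. -/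
def uniformStates [MeasurableSpace H₂] (hd : finrank ℂ H₁ ≤ finrank ℂ H₂)
    (ρ : DensityOperator H₁) : Measure (H₁ ⊗[ℂ] H₂) :=
  (uniformONS H₂ hd).map (schmidtMap ρ)

end Uniform

end GAPTypicality

end

/-! Write `ψ = ∑ √p_i χ_i ⊗ U e_i` with `U` Haar distributed. Then `⟨b_j|ψ⟩ = K(w_j)`, where `w_j =
U⁻¹ b_j` and `K` (`condVec`) reads only `d₁` coordinates of its argument. After an affine change of
`f` to a function `q` with values in `[0, 1]`, both integrals involve the single function `A =
homExt q ∘ K`: the conditional law gives `∑ j, A(w_j)`, and `GAP(ρ₁)` gives the mean `m` of `A`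
under the standard Gaussian on `H₂`. This `A` is homogeneous of degree two and bounded by the
squared norm of the `d₁` relevant coordinates.

The Haar mean of the sum is exactly `m` (`lintegral_sum_invAct`), so Chebyshev's inequality only
needs an upper bound for the second moment. Given `w_j`, every other `w_l` is uniform on the unit
sphere of the complement of `w_j`, which is compared with a Gaussian projected off `w_j`. In the
relevant coordinates that projection merely shrinks one direction, and a shrunk Gaussian is
dominated by the original one up to a factor near one (`lintegral_sub_inner_smul_le_add`). The
resulting variance is `O(1/d₂)` (`lintegral_sq_sum_invAct_le`).

Domination of measures needs no continuity of `f`, and `A` enters the bound only through its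
homogeneity, its coordinates and its size; hence the uniformity in `f`, `ρ₁` and `b`. -/

noncomputable section

set_option linter.unusedSectionVars false

namespace GAPTypicality

/-! ### The standard complex Gaussian -/

theorem measurable_complex_mk : Measurable (fun z : ℝ × ℝ => (⟨z.1, z.2⟩ : ℂ)) :=
  Complex.measurableEquivRealProd.symm.measurable

instance isProbabilityMeasure_stdComplexGaussian : IsProbabilityMeasure stdComplexGaussian :=
  Measure.isProbabilityMeasure_map measurable_complex_mk.aemeasurable

theorem lintegral_stdComplexGaussian {f : ℂ → ℝ≥0∞} (hf : Measurable f) :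
    ∫⁻ z, f z ∂stdComplexGaussian =
      ∫⁻ x, ∫⁻ y, f ⟨x, y⟩ ∂gaussianReal 0 (1 / 2) ∂gaussianReal 0 (1 / 2) := by
  rw [stdComplexGaussian, lintegral_map hf measurable_complex_mk,
    lintegral_prod (fun z : ℝ × ℝ => f ⟨z.1, z.2⟩) (hf.comp measurable_complex_mk).aemeasurable]

theorem lintegral_sq_gaussianReal_half :
    ∫⁻ x, ENNReal.ofReal (x ^ 2) ∂gaussianReal 0 (1 / 2) = 2⁻¹ := by
  have h := variance_id_gaussianReal (μ := 0) (v := 1 / 2)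
  rw [variance_eq_integral measurable_id.aemeasurable] at h
  simp only [id, integral_id_gaussianReal, sub_zero] at h
  have hL : MemLp (id : ℝ → ℝ) 2 (gaussianReal 0 (1 / 2)) := memLp_id_gaussianReal 2
  have h2 := ofReal_integral_eq_lintegral_ofReal hL.integrable_sq
    (Filter.Eventually.of_forall fun x => sq_nonneg x)
  simp only [id] at h2
  rw [← h2, h]
  simp [ENNReal.ofReal_inv_of_pos]

theorem enorm_sq_complex (x y : ℝ) :
    ‖(⟨x, y⟩ : ℂ)‖ₑ ^ 2 = ENNReal.ofReal (x ^ 2) + ENNReal.ofReal (y ^ 2) := by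
  rw [← ofReal_norm, ← ENNReal.ofReal_pow (norm_nonneg _), ← ENNReal.ofReal_add (by positivity)
    (by positivity), Complex.sq_norm, Complex.normSq_mk]
  ring_nf

theorem lintegral_enorm_sq_stdComplexGaussian :
    ∫⁻ z, ‖z‖ₑ ^ 2 ∂stdComplexGaussian = 1 := by
  rw [lintegral_stdComplexGaussian (by fun_prop)]
  simp_rw [enorm_sq_complex]
  have h1 (x : ℝ) : ∫⁻ y, (ENNReal.ofReal (x ^ 2) + ENNReal.ofReal (y ^ 2))
      ∂gaussianReal 0 (1 / 2) = ENNReal.ofReal (x ^ 2) + 2⁻¹ := by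
    rw [lintegral_add_left (by fun_prop), lintegral_sq_gaussianReal_half]
    simp
  simp_rw [h1]
  rw [lintegral_add_left (by fun_prop), lintegral_sq_gaussianReal_half]
  simp [ENNReal.inv_two_add_inv_two]

theorem lintegral_pow_four_gaussianReal_lt_top (v : ℝ≥0) :
    ∫⁻ x, ENNReal.ofReal (x ^ 2) ^ 2 ∂gaussianReal 0 v < ∞ := by
  have hL : MemLp (id : ℝ → ℝ) 4 (gaussianReal 0 v) := memLp_id_gaussianReal 4
  have := hL.integrable_norm_pow (p := 4) (by norm_num)
  have h := this.lintegral_lt_top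
  refine lt_of_eq_of_lt (lintegral_congr fun x => ?_) h
  rw [← ENNReal.ofReal_pow (by positivity)]
  congr 1
  simp only [id, Real.norm_eq_abs]
  rw [← pow_mul, Even.pow_abs (by decide)]

/-- Finiteness suffices: the fourth moment enters `varianceConst` without being evaluated. -/
theorem lintegral_enorm_pow_four_stdComplexGaussian_lt_top :
    ∫⁻ z, ‖z‖ₑ ^ 4 ∂stdComplexGaussian < ∞ := by
  rw [lintegral_stdComplexGaussian (by fun_prop)]
  have hle (x y : ℝ) : ‖(⟨x, y⟩ : ℂ)‖ₑ ^ 4 ≤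
      2 * ENNReal.ofReal (x ^ 2) ^ 2 + 2 * ENNReal.ofReal (y ^ 2) ^ 2 := by
    rw [show 4 = 2 * 2 from rfl, pow_mul, enorm_sq_complex, ← ENNReal.ofReal_pow (by positivity),
      ← ENNReal.ofReal_pow (by positivity), ← ENNReal.ofReal_add (by positivity) (by positivity),
      ← ENNReal.ofReal_pow (by positivity), ← ENNReal.ofReal_ofNat,
      ← ENNReal.ofReal_mul (by positivity), ← ENNReal.ofReal_mul (by positivity),
      ← ENNReal.ofReal_add (by positivity) (by positivity)]
    apply ENNReal.ofReal_le_ofReal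
    nlinarith [sq_nonneg (x ^ 2 - y ^ 2)]
  refine lt_of_le_of_lt (lintegral_mono fun x => lintegral_mono fun y => hle x y) ?_
  have hc := lintegral_pow_four_gaussianReal_lt_top (1 / 2)
  have h1 (x : ℝ) : ∫⁻ y, (2 * ENNReal.ofReal (x ^ 2) ^ 2 + 2 * ENNReal.ofReal (y ^ 2) ^ 2)
      ∂gaussianReal 0 (1 / 2) = 2 * ENNReal.ofReal (x ^ 2) ^ 2 +
        2 * ∫⁻ y, ENNReal.ofReal (y ^ 2) ^ 2 ∂gaussianReal 0 (1 / 2) := by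
    rw [lintegral_add_left (by fun_prop), lintegral_const, measure_univ, mul_one,
      lintegral_const_mul _ (by fun_prop)]
  simp_rw [h1]
  rw [lintegral_add_left (by fun_prop), lintegral_const_mul _ (by fun_prop)]
  simp only [lintegral_const, measure_univ, mul_one]
  exact ENNReal.add_lt_top.2 ⟨ENNReal.mul_lt_top (by simp) hc, ENNReal.mul_lt_top (by simp) hc⟩

/-- Compare densities: shrinking raises the normalising constant by `c⁻¹` and makes the exponential
smaller. -/
theorem gaussianReal_map_const_mul_le {c : ℝ} (hc : 0 < c) (hc1 : c ≤ 1) {v : ℝ≥0} (hv : v ≠ 0) :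
    (gaussianReal 0 v).map (c * ·) ≤ ENNReal.ofReal c⁻¹ • gaussianReal 0 v := by
  have hcv : NNReal.mk (c ^ 2) (sq_nonneg c) * v ≠ 0 := by
    refine mul_ne_zero ?_ hv
    simp [← NNReal.coe_ne_zero, hc.ne']
  rw [gaussianReal_map_const_mul, mul_zero, gaussianReal_of_var_ne_zero _ hv,
    gaussianReal_of_var_ne_zero _ hcv, ← withDensity_smul _ (measurable_gaussianPDF 0 v)]
  refine withDensity_mono (Filter.Eventually.of_forall fun x => ?_)
  have h0 : 0 ≤ c⁻¹ := by positivity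
  simp only [gaussianPDF, Pi.smul_apply, smul_eq_mul]
  rw [← ENNReal.ofReal_mul h0]
  apply ENNReal.ofReal_le_ofReal
  rw [gaussianPDFReal, gaussianPDFReal, ← mul_assoc]
  have hv' : (0 : ℝ) < v := lt_of_le_of_ne v.2 (fun h => hv (NNReal.coe_eq_zero.1 h.symm))
  push_cast
  have hs : √(2 * Real.pi * (c ^ 2 * v)) = c * √(2 * Real.pi * v) := by
    rw [show 2 * Real.pi * (c ^ 2 * v) = c ^ 2 * (2 * Real.pi * v) by ring,
      Real.sqrt_mul (sq_nonneg c), Real.sqrt_sq hc.le]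
  change (√(2 * Real.pi * (c ^ 2 * v)))⁻¹ * Real.exp (-(x - 0) ^ 2 / (2 * (c ^ 2 * v))) ≤ _
  rw [hs, mul_inv]
  refine mul_le_mul_of_nonneg_left (Real.exp_le_exp.2 ?_) (by positivity)
  rw [neg_div, neg_div, neg_le_neg_iff]
  gcongr
  exact mul_le_of_le_one_left hv'.le (pow_le_one₀ hc.le hc1)

/-- A complex line has two real dimensions, so the real factor `c⁻¹` occurs twice. -/
theorem lintegral_ofReal_mul_stdComplexGaussian_le {c : ℝ} (hc : 0 < c) (hc1 : c ≤ 1)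
    {f : ℂ → ℝ≥0∞} (hf : Measurable f) :
    ∫⁻ z, f (c * z) ∂stdComplexGaussian ≤
      ENNReal.ofReal (c ^ 2)⁻¹ * ∫⁻ z, f z ∂stdComplexGaussian := by
  have hv : (1 / 2 : ℝ≥0) ≠ 0 := by norm_num
  have key {g : ℝ → ℝ≥0∞} (hg : Measurable g) : ∫⁻ x, g (c * x) ∂gaussianReal 0 (1 / 2) ≤
      ENNReal.ofReal c⁻¹ * ∫⁻ x, g x ∂gaussianReal 0 (1 / 2) := by
    rw [← lintegral_map hg (measurable_const_mul c), ← smul_eq_mul, ← lintegral_smul_measure]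
    exact lintegral_mono' (gaussianReal_map_const_mul_le hc hc1 hv) le_rfl
  have hm : Measurable fun z : ℝ × ℝ => f ⟨z.1, z.2⟩ := hf.comp measurable_complex_mk
  rw [lintegral_stdComplexGaussian (f := fun z => f (c * z)) (by fun_prop),
    lintegral_stdComplexGaussian hf]
  have hmul (x y : ℝ) : (c : ℂ) * ⟨x, y⟩ = ⟨c * x, c * y⟩ := by
    apply Complex.ext <;> simp
  simp_rw [hmul]
  have h0 : 0 ≤ c⁻¹ := by positivity
  rw [show (c ^ 2)⁻¹ = c⁻¹ * c⁻¹ by rw [sq, mul_inv], ENNReal.ofReal_mul h0, mul_assoc]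
  refine le_trans (lintegral_mono fun x => key (g := fun y => f ⟨c * x, y⟩)
    (hm.comp measurable_prodMk_left)) ?_
  have hm2 : Measurable fun x => ∫⁻ y, f ⟨x, y⟩ ∂gaussianReal 0 (1 / 2) := hm.lintegral_prod_right'
  rw [lintegral_const_mul (ENNReal.ofReal c⁻¹)
    (f := fun x => ∫⁻ y, f ⟨c * x, y⟩ ∂gaussianReal 0 (1 / 2))
    (hm2.comp (measurable_const_mul c))]
  gcongr
  exact key hm2

theorem integral_exp_inner_stdComplexGaussian (w : ℂ) :
    ∫ z, Complex.exp (((w.re * z.re + w.im * z.im : ℝ) : ℂ) * Complex.I) ∂stdComplexGaussian =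
      Complex.exp (-(‖w‖ ^ 2 / 4 : ℝ)) := by
  have hc (t : ℝ) : ∫ x : ℝ, Complex.exp ((t * x : ℝ) * Complex.I) ∂gaussianReal 0 (1 / 2) =
      Complex.exp (-(t ^ 2 / 4 : ℝ)) := by
    have := charFun_gaussianReal (μ := 0) (v := 1 / 2) t
    rw [charFun_apply_real] at this
    simp only [Complex.ofReal_mul]
    rw [this]
    congr 1
    push_cast
    simp
    ring
  rw [stdComplexGaussian, integral_map measurable_complex_mk.aemeasurable
    (Measurable.aestronglyMeasurable (by fun_prop))]
  simp only [Complex.ofReal_add, add_mul, Complex.exp_add]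
  rw [integral_prod_mul (fun x : ℝ => Complex.exp ((w.re * x : ℝ) * Complex.I))
    (fun y : ℝ => Complex.exp ((w.im * y : ℝ) * Complex.I)), hc, hc, ← Complex.exp_add,
    Complex.sq_norm, Complex.normSq_apply]
  congr 1
  push_cast
  ring

/-! ### The standard Gaussian measure of a complex Hilbert space -/

section

variable {H : Type*} [NormedAddCommGroup H] [InnerProductSpace ℂ H] [FiniteDimensional ℂ H]
  [MeasurableSpace H] [BorelSpace H] {ι ι' : Type*} [Fintype ι] [Fintype ι']

/-- The law of `∑ i, Z_i e_i` with independent standard complex Gaussians `Z_i`. -/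
def stdGaussianOf (e : OrthonormalBasis ι ℂ H) : Measure H :=
  (Measure.pi fun _ : ι => stdComplexGaussian).map fun z => ∑ i, z i • e i

theorem measurable_sum_smul (e : ι → H) : Measurable fun z : ι → ℂ => ∑ i, z i • e i :=
  (by fun_prop : Continuous fun z : ι → ℂ => ∑ i, z i • e i).measurable

instance isProbabilityMeasure_stdGaussianOf (e : OrthonormalBasis ι ℂ H) :
    IsProbabilityMeasure (stdGaussianOf e) :=
  Measure.isProbabilityMeasure_map (measurable_sum_smul e).aemeasurable

theorem lintegral_stdGaussianOf (e : OrthonormalBasis ι ℂ H) {f : H → ℝ≥0∞} (hf : Measurable f) :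
    ∫⁻ x, f x ∂stdGaussianOf e =
      ∫⁻ z, f (∑ i, z i • e i) ∂Measure.pi fun _ : ι => stdComplexGaussian :=
  lintegral_map hf (measurable_sum_smul e)

theorem integral_exp_inner_stdGaussianOf (e : OrthonormalBasis ι ℂ H) (t : H) :
    ∫ x, Complex.exp (((inner ℂ x t).re : ℂ) * Complex.I) ∂stdGaussianOf e =
      Complex.exp (-(‖t‖ ^ 2 / 4 : ℝ)) := by
  rw [stdGaussianOf, integral_map (measurable_sum_smul e).aemeasurable
    (by apply Continuous.aestronglyMeasurable; fun_prop)]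
  have h1 (z : ι → ℂ) : Complex.exp (((inner ℂ (∑ i, z i • e i) t).re : ℂ) * Complex.I) =
      ∏ i, Complex.exp ((((inner ℂ (e i) t).re * (z i).re + (inner ℂ (e i) t).im * (z i).im : ℝ)
        : ℂ) * Complex.I) := by
    rw [← Complex.exp_sum, ← Finset.sum_mul, sum_inner, Complex.re_sum, Complex.ofReal_sum]
    congr 2
    refine Finset.sum_congr rfl fun i _ => ?_
    rw [inner_smul_left]
    simp
    ring
  simp_rw [h1]
  rw [integral_fintype_prod_eq_prod (fun i (z : ℂ) => Complex.exp
    ((((inner ℂ (e i) t).re * z.re + (inner ℂ (e i) t).im * z.im : ℝ) : ℂ) * Complex.I))]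
  simp_rw [integral_exp_inner_stdComplexGaussian]
  rw [← Complex.exp_sum, ← e.sum_sq_norm_inner_right t, Finset.sum_div]
  simp

/-- Two linear images of standard Gaussians agree when their adjoints have the same norms. -/
theorem map_stdGaussianOf_eq (e : OrthonormalBasis ι ℂ H) (e' : OrthonormalBasis ι' ℂ H)
    {L M L' M' : H →L[ℂ] H} (hL : ∀ x t, inner ℂ (L x) t = inner ℂ x (L' t))
    (hM : ∀ x t, inner ℂ (M x) t = inner ℂ x (M' t)) (h : ∀ t, ‖L' t‖ = ‖M' t‖) :
    (stdGaussianOf e).map L = (stdGaussianOf e').map M := by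
  -- Characteristic functions use the real inner product, the real part of the complex one. At `t`
  -- the image under `L` has the value `exp (-‖L' t‖² / 4)`, so the adjoint norms determine the law.
  let _ : InnerProductSpace ℝ H := InnerProductSpace.complexToReal
  have : FiniteDimensional ℝ H := FiniteDimensional.complexToReal H
  have := FiniteDimensional.complete ℝ H
  have := FiniteDimensional.proper ℝ H
  have := Measure.isProbabilityMeasure_map (μ := stdGaussianOf e) L.continuous.measurable.aemeasurable
  have := Measure.isProbabilityMeasure_map (μ := stdGaussianOf e') M.continuous.measurable.aemeasurable
  refine Measure.ext_of_charFun (funext fun t => ?_)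
  have hr (x y : H) : (inner ℝ x y : ℝ) = (inner ℂ x y).re := rfl
  simp only [charFun_apply]
  rw [integral_map L.continuous.measurable.aemeasurable
    (by apply Continuous.aestronglyMeasurable; fun_prop),
    integral_map M.continuous.measurable.aemeasurable
    (by apply Continuous.aestronglyMeasurable; fun_prop)]
  simp_rw [hr, hL, hM, integral_exp_inner_stdGaussianOf, h]

/-- Basis independence lets each Gaussian moment be computed in whichever basis suits it. -/
theorem stdGaussianOf_eq (e : OrthonormalBasis ι ℂ H) (e' : OrthonormalBasis ι' ℂ H) :
    stdGaussianOf e = stdGaussianOf e' := by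
  simpa using map_stdGaussianOf_eq e e' (L := .id ℂ H) (M := .id ℂ H) (L' := .id ℂ H)
    (M' := .id ℂ H) (by simp) (by simp) (by simp)

theorem lintegral_map_eq_of_norm_adjoint (e : OrthonormalBasis ι ℂ H) {L M L' M' : H →L[ℂ] H}
    (hL : ∀ x t, inner ℂ (L x) t = inner ℂ x (L' t))
    (hM : ∀ x t, inner ℂ (M x) t = inner ℂ x (M' t)) (h : ∀ t, ‖L' t‖ = ‖M' t‖)
    {f : H → ℝ≥0∞} (hf : Measurable f) :
    ∫⁻ x, f (L x) ∂stdGaussianOf e = ∫⁻ x, f (M x) ∂stdGaussianOf e := by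
  rw [← lintegral_map hf L.continuous.measurable, map_stdGaussianOf_eq e e hL hM h,
    lintegral_map hf M.continuous.measurable]

end

/-! ### Coordinate projections and their Gaussian moments -/

section

variable {H : Type*} [NormedAddCommGroup H] [InnerProductSpace ℂ H] {ι : Type*} [Fintype ι]

/-- The orthogonal projection onto the span of the basis vectors `e_i`, `i ∈ s`. -/
def coordProj (e : OrthonormalBasis ι ℂ H) (s : Finset ι) : H →L[ℂ] H :=
  ∑ i ∈ s, InnerProductSpace.rankOne ℂ (e i) (e i)

variable (e : OrthonormalBasis ι ℂ H) (s : Finset ι)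

theorem coordProj_apply (x : H) : coordProj e s x = ∑ i ∈ s, inner ℂ (e i) x • e i := by
  simp [coordProj]

theorem inner_coordProj_left (x y : H) :
    inner ℂ (coordProj e s x) y = inner ℂ x (coordProj e s y) := by
  simp only [coordProj_apply, sum_inner, inner_sum, inner_smul_left, inner_smul_right,
    inner_conj_symm]
  exact Finset.sum_congr rfl fun i _ => mul_comm _ _

theorem inner_basis_coordProj [DecidableEq ι] (i : ι) (x : H) :
    inner ℂ (e i) (coordProj e s x) = if i ∈ s then inner ℂ (e i) x else 0 := by
  simp [coordProj_apply, e.inner_eq_ite]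

theorem coordProj_coordProj (x : H) : coordProj e s (coordProj e s x) = coordProj e s x := by
  classical
  conv_lhs => rw [coordProj_apply]
  conv_rhs => rw [coordProj_apply]
  refine Finset.sum_congr rfl fun i hi => ?_
  rw [inner_basis_coordProj, if_pos hi]

theorem norm_sq_coordProj (x : H) :
    ‖coordProj e s x‖ ^ 2 = ∑ i ∈ s, ‖inner ℂ (e i) x‖ ^ 2 := by
  classical
  rw [← e.sum_sq_norm_inner_right]
  simp_rw [inner_basis_coordProj]
  simp [apply_ite, Finset.sum_ite_mem]

theorem norm_coordProj_le (x : H) : ‖coordProj e s x‖ ≤ ‖x‖ := by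
  refine le_of_sq_le_sq ?_ (norm_nonneg _)
  rw [norm_sq_coordProj, ← e.sum_sq_norm_inner_right]
  exact Finset.sum_le_univ_sum_of_nonneg fun i => by positivity

theorem ofReal_sq_norm {E : Type*} [SeminormedAddCommGroup E] (x : E) :
    ENNReal.ofReal (‖x‖ ^ 2) = ‖x‖ₑ ^ 2 := by
  rw [ENNReal.ofReal_pow (norm_nonneg _), ofReal_norm]

theorem enorm_sq_coordProj (x : H) :
    ‖coordProj e s x‖ₑ ^ 2 = ∑ i ∈ s, ‖inner ℂ (e i) x‖ₑ ^ 2 := by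
  simp_rw [← ofReal_sq_norm]
  rw [norm_sq_coordProj, ENNReal.ofReal_sum_of_nonneg fun i _ => by positivity]

theorem coordProj_univ (x : H) : coordProj e Finset.univ x = x := by
  rw [coordProj_apply, e.sum_repr']

theorem coordProj_erase_univ [DecidableEq ι] (j : ι) (x : H) :
    coordProj e (Finset.univ.erase j) x = x - inner ℂ (e j) x • e j := by
  conv_rhs => enter [1]; rw [← coordProj_univ e x]
  rw [coordProj_apply, coordProj_apply, ← Finset.sum_erase_add _ _ (Finset.mem_univ j)]
  simp

/-- Used with `c = 1` for the projection off `u`, and with `c = 1 - β` for the contraction by `β`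
along `u`. -/
theorem norm_sq_sub_inner_smul {u : H} (hu : ‖u‖ = 1) (c : ℝ) (x : H) :
    ‖x - (c * inner ℂ u x) • u‖ ^ 2 = ‖x‖ ^ 2 - (2 * c - c ^ 2) * ‖inner ℂ u x‖ ^ 2 := by
  rw [norm_sub_sq (𝕜 := ℂ), inner_smul_right, norm_smul, hu, ← inner_conj_symm x u]
  rw [mul_assoc, Complex.mul_conj, Complex.normSq_eq_norm_sq, norm_mul, Complex.norm_real]
  simp only [RCLike.re_to_complex, ← Complex.ofReal_mul, Complex.ofReal_re, mul_one, mul_pow,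
    Real.norm_eq_abs, sq_abs]
  ring

theorem exists_orthonormalBasis_eq [Nonempty ι] (e : OrthonormalBasis ι ℂ H) {u : H}
    (hu : ‖u‖ = 1) : ∃ (b : OrthonormalBasis ι ℂ H) (i : ι), b i = u := by
  have : FiniteDimensional ℂ H := e.toBasis.finiteDimensional_of_finite
  obtain ⟨i⟩ := ‹Nonempty ι›
  obtain ⟨b, hb⟩ := Orthonormal.exists_orthonormalBasis_extension_of_card_eq (𝕜 := ℂ)
    (v := fun _ : ι => u) (s := {i}) (finrank_eq_card_basis e.toBasis)
    ⟨fun _ => hu, fun x y h => (h (Subsingleton.elim x y)).elim⟩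
  exact ⟨b, i, hb i rfl⟩

variable [FiniteDimensional ℂ H] [MeasurableSpace H] [BorelSpace H]

theorem lintegral_inner_stdGaussianOf (i : ι) {f : ℂ → ℝ≥0∞} (hf : Measurable f) :
    ∫⁻ x, f (inner ℂ (e i) x) ∂stdGaussianOf e = ∫⁻ z, f z ∂stdComplexGaussian := by
  rw [lintegral_stdGaussianOf e (f := fun x => f (inner ℂ (e i) x)) (hf.comp (by fun_prop))]
  simp_rw [e.orthonormal.inner_right_fintype]
  exact (measurePreserving_eval (fun _ : ι => stdComplexGaussian) i).lintegral_comp hf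

theorem lintegral_sq_coordProj :
    ∫⁻ x, ‖coordProj e s x‖ₑ ^ 2 ∂stdGaussianOf e = s.card := by
  simp_rw [enorm_sq_coordProj]
  rw [lintegral_finsetSum _ fun i _ => by fun_prop]
  rw [Finset.sum_congr rfl fun i _ => (lintegral_inner_stdGaussianOf e i
    (f := fun z => ‖z‖ₑ ^ 2) (by fun_prop)).trans lintegral_enorm_sq_stdComplexGaussian]
  simp

theorem lintegral_sq_enorm : ∫⁻ x, ‖x‖ₑ ^ 2 ∂stdGaussianOf e = Fintype.card ι := by
  simpa [coordProj_univ] using lintegral_sq_coordProj e Finset.univ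

/-- Jensen's inequality for the squared norm, obtained by integrating `2 d r ≤ r² + d²`. It turns
Gaussian fourth moments into bounds of order `d⁻²` on the sphere. -/
theorem sq_card_le_lintegral_pow_four :
    (Fintype.card ι : ℝ≥0∞) ^ 2 ≤ ∫⁻ x, ‖x‖ₑ ^ 4 ∂stdGaussianOf e := by
  set d : ℝ≥0∞ := (Fintype.card ι : ℝ≥0∞) with hd
  have hdt : d ^ 2 ≠ ∞ := by simp [hd]
  have hp (x : H) : 2 * d * ‖x‖ₑ ^ 2 ≤ ‖x‖ₑ ^ 4 + d ^ 2 := by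
    have : d = ENNReal.ofReal (Fintype.card ι) := by simp [hd]
    rw [this, ← ofReal_norm, ← ENNReal.ofReal_ofNat, ← ENNReal.ofReal_mul (by positivity),
      ← ENNReal.ofReal_pow (by positivity), ← ENNReal.ofReal_pow (by positivity),
      ← ENNReal.ofReal_pow (by positivity), ← ENNReal.ofReal_mul (by positivity),
      ← ENNReal.ofReal_add (by positivity) (by positivity)]
    apply ENNReal.ofReal_le_ofReal
    nlinarith [sq_nonneg (‖x‖ ^ 2 - Fintype.card ι)]
  have h := lintegral_mono (μ := stdGaussianOf e) hp
  rw [lintegral_const_mul _ (by fun_prop), lintegral_sq_enorm,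
    lintegral_add_left (by fun_prop), lintegral_const, measure_univ, mul_one, ← hd] at h
  refine (ENNReal.add_le_add_iff_right hdt).1 (le_trans (le_of_eq ?_) h)
  ring

/-- Cauchy–Schwarz over the coordinates in `s`; the bound does not involve the dimension of `H`. -/
theorem lintegral_pow_four_coordProj_le :
    ∫⁻ x, ‖coordProj e s x‖ₑ ^ 4 ∂stdGaussianOf e ≤
      s.card ^ 2 * ∫⁻ z, ‖z‖ₑ ^ 4 ∂stdComplexGaussian := by
  have hp (x : H) : ‖coordProj e s x‖ₑ ^ 4 ≤ s.card * ∑ i ∈ s, ‖inner ℂ (e i) x‖ₑ ^ 4 := by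
    have hc (c : ℝ≥0∞) : c ^ 4 = (c ^ 2) ^ 2 := by ring
    simp_rw [hc]
    rw [enorm_sq_coordProj]
    simp_rw [enorm_eq_nnnorm]
    norm_cast
    exact sq_sum_le_card_mul_sum_sq
  refine (lintegral_mono hp).trans (le_of_eq ?_)
  rw [lintegral_const_mul _ (by fun_prop), lintegral_finsetSum _ fun i _ => by fun_prop]
  rw [Finset.sum_congr rfl fun i _ => lintegral_inner_stdGaussianOf e i
    (f := fun z => ‖z‖ₑ ^ 4) (by fun_prop)]
  simp
  ring

/-! ### Shrinking one direction -/

/-- Integrating over coordinate `i` alone reduces this to the bound in one complex variable. -/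
theorem lintegral_pi_update_mul_le [DecidableEq ι] (i : ι) {c : ℝ} (hc : 0 < c) (hc1 : c ≤ 1)
    {f : (ι → ℂ) → ℝ≥0∞} (hf : Measurable f) :
    ∫⁻ z, f (Function.update z i (c * z i)) ∂(Measure.pi fun _ : ι => stdComplexGaussian) ≤
      ENNReal.ofReal (c ^ 2)⁻¹ * ∫⁻ z, f z ∂Measure.pi fun _ : ι => stdComplexGaussian := by
  have hu : Measurable fun z : ι → ℂ => Function.update z i (c * z i) := by
    refine measurable_pi_iff.2 fun j => ?_
    by_cases h : j = i
    · subst h; simp; fun_prop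
    · simp [h]; fun_prop
  rw [← lintegral_const_mul _ hf]
  refine lintegral_le_of_lmarginal_le {i} (hf.comp hu) (hf.const_mul _) fun x => ?_
  rw [lmarginal_singleton, lmarginal_singleton]
  simp only [Function.update_self, Function.update_idem]
  have hm : Measurable fun y : ℂ => f (Function.update x i y) := hf.comp (measurable_update x)
  rw [lintegral_const_mul _ hm]
  exact lintegral_ofReal_mul_stdComplexGaussian_le hc hc1 hm

/-- In an orthonormal basis containing `u` the map multiplies a single coordinate by `c`. -/
theorem lintegral_sub_inner_smul_le {u : H} (hu : ‖u‖ = 1) {c : ℝ} (hc : 0 < c) (hc1 : c ≤ 1)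
    {f : H → ℝ≥0∞} (hf : Measurable f) :
    ∫⁻ x, f (x - (((1 - c : ℝ) : ℂ) * inner ℂ u x) • u) ∂stdGaussianOf e ≤
      ENNReal.ofReal (c ^ 2)⁻¹ * ∫⁻ x, f x ∂stdGaussianOf e := by
  classical
  have hne : Nonempty ι := by
    by_contra h
    rw [not_nonempty_iff] at h
    have : u = 0 := by simpa using (e.sum_repr' u).symm
    simp [this] at hu
  obtain ⟨b, i, rfl⟩ := exists_orthonormalBasis_eq e hu
  rw [stdGaussianOf_eq e b, lintegral_stdGaussianOf b hf, lintegral_stdGaussianOf b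
    (f := fun x => f (x - (((1 - c : ℝ) : ℂ) * inner ℂ (b i) x) • b i)) (hf.comp (by fun_prop))]
  refine le_trans (le_of_eq (lintegral_congr fun z => ?_))
    (lintegral_pi_update_mul_le i hc hc1 (hf.comp (measurable_sum_smul b)))
  rw [b.orthonormal.inner_right_fintype]
  congr 1
  rw [← Finset.sum_erase_add _ _ (Finset.mem_univ i),
    ← Finset.sum_erase_add (Finset.univ) _ (Finset.mem_univ i), Function.update_self,
    add_sub_assoc, ← sub_smul]
  congr 1
  · refine Finset.sum_congr rfl fun j hj => ?_
    rw [Function.update_of_ne (Finset.ne_of_mem_erase hj)]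
  · congr 1
    push_cast
    ring

/-- Projecting the Gaussian vector orthogonally to a unit vector `w` that is almost orthogonal to
the coordinates that `A` depends on barely increases the expectation of `A`. -/
theorem lintegral_sub_inner_smul_le_add {A : H → ℝ≥0∞} (hA : Measurable A)
    (hproj : ∀ x, A (coordProj e s x) = A x) (hle : ∀ x, A x ≤ ‖coordProj e s x‖ₑ ^ 2)
    {w : H} (hw : ‖w‖ = 1) :
    ∫⁻ x, A (x - inner ℂ w x • w) ∂stdGaussianOf e ≤
      ∫⁻ x, A x ∂stdGaussianOf e + 2 * s.card * ‖coordProj e s w‖ₑ ^ 2 := by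
  set a := coordProj e s w with ha
  by_cases ha0 : a = 0
  · refine le_trans (le_of_eq (lintegral_congr fun x => ?_)) le_self_add
    rw [← hproj, map_sub, map_smul, ← ha, ha0, smul_zero, sub_zero, hproj]
  have hτ0 : 0 < ‖a‖ := norm_pos_iff.2 ha0
  have hτ1 : ‖a‖ ≤ 1 := hw ▸ norm_coordProj_le e s w
  set u : H := ((‖a‖⁻¹ : ℝ) : ℂ) • a with hu
  have hu1 : ‖u‖ = 1 := by
    rw [hu, norm_smul, Complex.norm_real, Real.norm_of_nonneg (by positivity),
      inv_mul_cancel₀ hτ0.ne']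
  have hPu : coordProj e s u = u := by rw [hu, map_smul, ha, coordProj_coordProj]
  -- On the range of `coordProj e s`, the compression of the projection off `w` is `y ↦ y - ‖a‖² ⟨u,
  -- y⟩ u`. This is the square of the contraction `T` by `β` along `u`, so both Gaussian images have
  -- the same covariance there.
  set β := √(1 - ‖a‖ ^ 2) with hβ
  have hβ2 : β ^ 2 = 1 - ‖a‖ ^ 2 := Real.sq_sqrt (by nlinarith)
  have hβ0 : 0 ≤ β := Real.sqrt_nonneg _
  have hβ1 : β ≤ 1 := by nlinarith [sq_nonneg ‖a‖]
  let P : H →L[ℂ] H := .id ℂ H - InnerProductSpace.rankOne ℂ w w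
  let T : H →L[ℂ] H := .id ℂ H - ((1 - β : ℝ) : ℂ) • InnerProductSpace.rankOne ℂ u u
  have hP (x : H) : P x = x - inner ℂ w x • w := by simp [P]
  have hT (x : H) : T x = x - (((1 - β : ℝ) : ℂ) * inner ℂ u x) • u := by simp [T, smul_smul]
  have hPa (x t : H) : inner ℂ (P x) t = inner ℂ x (P t) := by
    rw [hP, hP, inner_sub_left, inner_sub_right, inner_smul_left, inner_smul_right,
      inner_conj_symm, mul_comm]
  have hTa (x t : H) : inner ℂ (T x) t = inner ℂ x (T t) := by
    rw [hT, hT, inner_sub_left, inner_sub_right, inner_smul_left, inner_smul_right, map_mul,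
      inner_conj_symm, Complex.conj_ofReal]
    ring
  have hnorm (t : H) : ‖P (coordProj e s t)‖ = ‖T (coordProj e s t)‖ := by
    set y := coordProj e s t with hy
    have hyy : coordProj e s y = y := coordProj_coordProj e s t
    have hin : inner ℂ w y = ‖a‖ * inner ℂ u y := by
      rw [← hyy, ← inner_coordProj_left, ← ha, hyy, hu, inner_smul_left, Complex.conj_ofReal,
        ← mul_assoc, ← Complex.ofReal_mul, mul_inv_cancel₀ hτ0.ne', Complex.ofReal_one, one_mul]
    have h1 := norm_sq_sub_inner_smul hw 1 y
    have h2 := norm_sq_sub_inner_smul hu1 (1 - β) y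
    rw [Complex.ofReal_one, one_mul, ← hP, hin, norm_mul, Complex.norm_real, norm_norm] at h1
    rw [← hT] at h2
    refine (pow_left_inj₀ (norm_nonneg _) (norm_nonneg _) two_ne_zero).1 ?_
    rw [h1, h2, mul_pow]
    linear_combination (-‖inner ℂ u y‖ ^ 2) * hβ2
  have hcomm (x : H) : coordProj e s (T x) = T (coordProj e s x) := by
    rw [hT, hT, map_sub, map_smul, hPu, ← inner_coordProj_left, hPu]
  have hkey : ∫⁻ x, A (x - inner ℂ w x • w) ∂stdGaussianOf e = ∫⁻ x, A (T x) ∂stdGaussianOf e := by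
    simp_rw [← hP]
    simp_rw [← hproj (P _), ← hproj (T _)]
    exact lintegral_map_eq_of_norm_adjoint e (L := (coordProj e s).comp P)
      (M := (coordProj e s).comp T) (L' := P.comp (coordProj e s))
      (M' := T.comp (coordProj e s)) (fun x t => by simp [inner_coordProj_left, hPa])
      (fun x t => by simp [inner_coordProj_left, hTa]) hnorm hA
  rw [hkey]
  have hk : ∫⁻ x, A x ∂stdGaussianOf e ≤ s.card :=
    (lintegral_mono hle).trans_eq (lintegral_sq_coordProj e s)
  have haE : ‖a‖ₑ ^ 2 = ENNReal.ofReal (‖a‖ ^ 2) := (ofReal_sq_norm a).symm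
  -- For `t ≤ 1/2` one has `1 / (1 - t) ≤ 1 + 2 t`, so domination applies. For larger `t` the error
  -- term `2 k t` alone exceeds the trivial bound `k`, the number of coordinates.
  rcases le_or_gt (‖a‖ ^ 2) (1 / 2) with h | h
  · have hβpos : 0 < β := Real.sqrt_pos.2 (by linarith)
    simp_rw [hT]
    refine (lintegral_sub_inner_smul_le e hu1 hβpos hβ1 hA).trans ?_
    have hc : ENNReal.ofReal (β ^ 2)⁻¹ ≤ 1 + 2 * ‖a‖ₑ ^ 2 := by
      rw [haE, ← ENNReal.ofReal_one, ← ENNReal.ofReal_ofNat, ← ENNReal.ofReal_mul (by norm_num),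
        ← ENNReal.ofReal_add (by norm_num) (by positivity)]
      apply ENNReal.ofReal_le_ofReal
      rw [hβ2, inv_le_iff_one_le_mul₀ (by linarith)]
      nlinarith [sq_nonneg ‖a‖]
    calc _ ≤ (1 + 2 * ‖a‖ₑ ^ 2) * ∫⁻ x, A x ∂stdGaussianOf e := by gcongr
      _ = ∫⁻ x, A x ∂stdGaussianOf e + 2 * (∫⁻ x, A x ∂stdGaussianOf e) * ‖a‖ₑ ^ 2 := by ring
      _ ≤ _ := by gcongr
  · have h1 : ∫⁻ x, A (T x) ∂stdGaussianOf e ≤ s.card := by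
      refine le_trans (lintegral_mono fun x => ?_) (lintegral_sq_coordProj e s).le
      refine (hle _).trans ?_
      rw [hcomm, ← ofReal_sq_norm, ← ofReal_sq_norm]
      apply ENNReal.ofReal_le_ofReal
      rw [hT, norm_sq_sub_inner_smul hu1]
      have : 0 ≤ 2 * (1 - β) - (1 - β) ^ 2 := by nlinarith
      nlinarith [mul_nonneg this (sq_nonneg ‖inner ℂ u (coordProj e s x)‖)]
    have h2 : (1 : ℝ≥0∞) ≤ 2 * ‖a‖ₑ ^ 2 := by
      rw [haE, ← ENNReal.ofReal_one, ← ENNReal.ofReal_ofNat, ← ENNReal.ofReal_mul (by norm_num)]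
      exact ENNReal.ofReal_le_ofReal (by linarith)
    calc _ ≤ (s.card : ℝ≥0∞) := h1
      _ ≤ s.card * (2 * ‖a‖ₑ ^ 2) := le_mul_of_one_le_right (by positivity) h2
      _ = 2 * s.card * ‖a‖ₑ ^ 2 := by ring
      _ ≤ _ := le_add_self

end

/-! ### Moments under the Haar measure of the unitary group -/

/-- Avoiding division includes the empty index set, which occurs for the off-diagonal terms in
dimension one. -/
theorem sum_le_of_card_mul_le {α : Type*} {s : Finset α} {a : α → ℝ≥0∞} {R : ℝ≥0∞}
    (h : ∀ i ∈ s, s.card * a i ≤ R) : ∑ i ∈ s, a i ≤ R := by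
  rcases s.eq_empty_or_nonempty with rfl | hs
  · simp
  have hc : (s.card : ℝ≥0∞) ≠ 0 := by simpa using hs.ne_empty
  rw [← ENNReal.mul_le_mul_iff_right hc (ENNReal.natCast_ne_top _), Finset.mul_sum,
    ← nsmul_eq_mul _ R]
  exact Finset.sum_le_card_nsmul _ _ _ h

section

variable {H : Type*} [NormedAddCommGroup H] [InnerProductSpace ℂ H] [FiniteDimensional ℂ H]
  [CompleteSpace H]

/-! ### Haar measure and the action of inverse unitaries -/

instance isProbabilityMeasure_haarUnitary : IsProbabilityMeasure (haarUnitary H) :=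
  ⟨Measure.haarMeasure_self (K₀ := (⊤ : TopologicalSpace.PositiveCompacts
    (unitary (H →L[ℂ] H))))⟩

instance isMulLeftInvariant_haarUnitary : (haarUnitary H).IsMulLeftInvariant :=
  Measure.isMulLeftInvariant_haarMeasure _

/-- The action of the inverse of a unitary operator. -/
def invAct (U : unitary (H →L[ℂ] H)) : H →L[ℂ] H := star (U : H →L[ℂ] H)

theorem inner_invAct_left (U : unitary (H →L[ℂ] H)) (x y : H) :
    inner ℂ (invAct U x) y = inner ℂ x ((U : H →L[ℂ] H) y) :=
  ContinuousLinearMap.adjoint_inner_left _ _ _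

theorem apply_invAct (U : unitary (H →L[ℂ] H)) (x : H) : (U : H →L[ℂ] H) (invAct U x) = x :=
  congrArg (fun T : H →L[ℂ] H => T x) (Unitary.coe_mul_star_self U)

theorem invAct_apply (U : unitary (H →L[ℂ] H)) (x : H) : invAct U ((U : H →L[ℂ] H) x) = x :=
  congrArg (fun T : H →L[ℂ] H => T x) (Unitary.coe_star_mul_self U)

theorem inner_apply_apply (U : unitary (H →L[ℂ] H)) (x y : H) :
    inner ℂ ((U : H →L[ℂ] H) x) ((U : H →L[ℂ] H) y) = inner ℂ x y := by
  rw [← inner_invAct_left, invAct_apply]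

theorem inner_invAct_invAct (U : unitary (H →L[ℂ] H)) (x y : H) :
    inner ℂ (invAct U x) (invAct U y) = inner ℂ x y := by
  rw [inner_invAct_left, apply_invAct]

theorem norm_apply_unitary (U : unitary (H →L[ℂ] H)) (x : H) : ‖(U : H →L[ℂ] H) x‖ = ‖x‖ := by
  rw [norm_eq_sqrt_re_inner (𝕜 := ℂ), inner_apply_apply, ← norm_eq_sqrt_re_inner]

theorem norm_invAct (U : unitary (H →L[ℂ] H)) (x : H) : ‖invAct U x‖ = ‖x‖ := by
  rw [norm_eq_sqrt_re_inner (𝕜 := ℂ), inner_invAct_invAct, ← norm_eq_sqrt_re_inner]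

variable {ι κ : Type*} [Fintype ι] [Fintype κ]

/-- Left translation by the unitary `W` with `W b' = b` replaces `U⁻¹ b` by `U⁻¹ W⁻¹ b = U⁻¹ b'`. -/
theorem lintegral_haarUnitary_basis (b b' : OrthonormalBasis ι ℂ H) (f : (ι → H) → ℝ≥0∞) :
    ∫⁻ U, f (fun i => invAct U (b i)) ∂haarUnitary H =
      ∫⁻ U, f (fun i => invAct U (b' i)) ∂haarUnitary H := by
  let W : unitary (H →L[ℂ] H) := Unitary.linearIsometryEquiv.symm (b'.equiv b (.refl ι))
  have hW (i : ι) : (W : H →L[ℂ] H) (b' i) = b i := by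
    simp [W]
  rw [← lintegral_mul_left_eq_self (μ := haarUnitary H) _ W]
  refine lintegral_congr fun U => congrArg f (funext fun i => ?_)
  simp only [invAct, Submonoid.coe_mul, star_mul, mul_apply_eq_comp, ← hW]
  exact congrArg _ (invAct_apply W _)

variable [MeasurableSpace H] [BorelSpace H]

/-! ### Joint measurability of the unitary action -/

theorem measurable_invAct_uncurry :
    Measurable fun p : unitary (H →L[ℂ] H) × H => invAct p.1 p.2 := by
  have := FiniteDimensional.proper ℂ H
  have : SecondCountableTopology H := inferInstance
  have : OpensMeasurableSpace (unitary (H →L[ℂ] H) × H) := Prod.opensMeasurableSpace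
  have hc : Continuous fun p : unitary (H →L[ℂ] H) × H => invAct p.1 p.2 :=
    (continuous_star.comp (continuous_subtype_val.comp continuous_fst)).clm_apply continuous_snd
  exact hc.measurable

theorem measurable_invAct (x : H) : Measurable fun U : unitary (H →L[ℂ] H) => invAct U x := by
  have hm : Measurable fun U : unitary (H →L[ℂ] H) => (U, x) := measurable_prodMk_right
  have h := (measurable_invAct_uncurry (H := H)).comp hm
  exact h

theorem measurable_invAct_apply {A : H → ℝ≥0∞} (hA : Measurable A) :
    Measurable fun p : unitary (H →L[ℂ] H) × H => A (invAct p.1 p.2) := by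
  have h := hA.comp (measurable_invAct_uncurry (H := H))
  exact h


variable (e : OrthonormalBasis κ ℂ H) (b : OrthonormalBasis ι ℂ H)

theorem lintegral_invAct_stdGaussianOf (U : unitary (H →L[ℂ] H)) {f : H → ℝ≥0∞}
    (hf : Measurable f) :
    ∫⁻ x, f (invAct U x) ∂stdGaussianOf e = ∫⁻ x, f x ∂stdGaussianOf e := by
  simpa using lintegral_map_eq_of_norm_adjoint e (L := invAct U) (L' := (U : H →L[ℂ] H))
    (M := .id ℂ H) (M' := .id ℂ H) (inner_invAct_left U) (by simp)
    (fun t => by simp [norm_apply_unitary]) hf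

/-- The normalised `x` and `b j` extend to an orthonormal basis with `x / ‖x‖` in place `l`, so
basis independence applies; homogeneity supplies the power of `‖x‖`. -/
theorem lintegral_haarUnitary_homogeneous_pair [DecidableEq ι] {A : H → ℝ≥0∞} {n : ℕ}
    (hn : n ≠ 0) (hom : ∀ (c : ℝ) x, 0 ≤ c → A ((c : ℂ) • x) = ENNReal.ofReal c ^ n * A x)
    (B : H → ℝ≥0∞) {j l : ι} (hjl : j ≠ l) {x : H} (hx : inner ℂ (b j) x = 0) :
    ∫⁻ U, B (invAct U (b j)) * A (invAct U x) ∂haarUnitary H =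
      ‖x‖ₑ ^ n * ∫⁻ U, B (invAct U (b j)) * A (invAct U (b l)) ∂haarUnitary H := by
  rcases eq_or_ne x 0 with rfl | hx0
  · have : A 0 = 0 := by simpa [hn] using hom 0 0 le_rfl
    simp [this, hn]
  have hx1 : 0 < ‖x‖ := norm_pos_iff.2 hx0
  set u : H := ((‖x‖⁻¹ : ℝ) : ℂ) • x with hu
  have hu1 : ‖u‖ = 1 := by
    rw [hu, norm_smul, Complex.norm_real, Real.norm_of_nonneg (by positivity),
      inv_mul_cancel₀ hx1.ne']
  have hux : x = (‖x‖ : ℂ) • u := by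
    rw [hu, smul_smul, ← Complex.ofReal_mul, mul_inv_cancel₀ hx1.ne', Complex.ofReal_one, one_smul]
  have hju : inner ℂ (b j) u = 0 := by rw [hu, inner_smul_right, hx, mul_zero]
  have hort : Orthonormal ℂ (({j, l} : Set ι).domRestrict (Function.update b l u)) := by
    have huj : inner ℂ u (b j) = 0 := inner_eq_zero_symm.1 hju
    have hmem (i : ({j, l} : Set ι)) : (i : ι) = j ∨ (i : ι) = l := i.2
    refine ⟨fun i => ?_, fun i i' hii' => ?_⟩
    · rcases hmem i with h | h <;> simp [h, hjl, b.norm_eq_one, hu1]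
    · have hne : (i : ι) ≠ i' := fun h => hii' (Subtype.ext h)
      simp only [Set.domRestrict_apply]
      rcases hmem i with h | h <;> rcases hmem i' with h' | h' <;> rw [h, h'] at hne ⊢
      · exact (hne rfl).elim
      · rw [Function.update_of_ne hjl, Function.update_self, hju]
      · rw [Function.update_of_ne hjl, Function.update_self, huj]
      · exact (hne rfl).elim
  obtain ⟨b', hb'⟩ := hort.exists_orthonormalBasis_extension_of_card_eq
    (finrank_eq_card_basis b.toBasis)
  have hj : b' j = b j := by rw [hb' j (by simp), Function.update_of_ne hjl]
  have hl : b' l = u := by rw [hb' l (by simp), Function.update_self]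
  have hb := lintegral_haarUnitary_basis b b' fun v => B (v j) * A (v l)
  simp only [hj, hl] at hb
  rw [hb, ← lintegral_const_mul' _ _ (by simp)]
  refine lintegral_congr fun U => ?_
  conv_lhs => rw [hux]
  rw [map_smul, hom _ _ (norm_nonneg _), ofReal_norm]
  ring

theorem lintegral_haarUnitary_homogeneous {A : H → ℝ≥0∞} {n : ℕ}
    (hn : n ≠ 0) (hom : ∀ (c : ℝ) x, 0 ≤ c → A ((c : ℂ) • x) = ENNReal.ofReal c ^ n * A x)
    (j : ι) (x : H) :
    ∫⁻ U, A (invAct U x) ∂haarUnitary H =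
      ‖x‖ₑ ^ n * ∫⁻ U, A (invAct U (b j)) ∂haarUnitary H := by
  rcases eq_or_ne x 0 with rfl | hx0
  · have : A 0 = 0 := by simpa [hn] using hom 0 0 le_rfl
    simp [this, hn]
  have hx1 : 0 < ‖x‖ := norm_pos_iff.2 hx0
  set u : H := ((‖x‖⁻¹ : ℝ) : ℂ) • x with hu
  have hu1 : ‖u‖ = 1 := by
    rw [hu, norm_smul, Complex.norm_real, Real.norm_of_nonneg (by positivity),
      inv_mul_cancel₀ hx1.ne']
  have hux : x = (‖x‖ : ℂ) • u := by
    rw [hu, smul_smul, ← Complex.ofReal_mul, mul_inv_cancel₀ hx1.ne', Complex.ofReal_one, one_smul]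
  obtain ⟨b', hb'⟩ := Orthonormal.exists_orthonormalBasis_extension_of_card_eq (𝕜 := ℂ)
    (v := fun _ : ι => u) (s := {j}) (finrank_eq_card_basis b.toBasis)
    ⟨fun _ => hu1, fun x y h => (h (Subsingleton.elim x y)).elim⟩
  have hb := lintegral_haarUnitary_basis b b' fun v => A (v j)
  simp only [hb' j rfl] at hb
  rw [hb, ← lintegral_const_mul' _ _ (by simp)]
  refine lintegral_congr fun U => ?_
  conv_lhs => rw [hux]
  rw [map_smul, hom _ _ (norm_nonneg _), ofReal_norm]

/-- A Haar distributed unit vector and a Gaussian vector give the same expectation to a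
homogeneous function, up to the moment of the norm. -/
theorem moment_mul_lintegral_haarUnitary {A : H → ℝ≥0∞} (hA : Measurable A) {n : ℕ}
    (hn : n ≠ 0) (hom : ∀ (c : ℝ) x, 0 ≤ c → A ((c : ℂ) • x) = ENNReal.ofReal c ^ n * A x)
    (j : ι) :
    (∫⁻ x, ‖x‖ₑ ^ n ∂stdGaussianOf e) * ∫⁻ U, A (invAct U (b j)) ∂haarUnitary H =
      ∫⁻ x, A x ∂stdGaussianOf e := by
  -- Fubini for `A (U⁻¹ x)` with `U` Haar and `x` Gaussian: integrating over `U` first gives the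
  -- left side, and over `x` first, by unitary invariance, the right side.
  rw [← lintegral_mul_const _ (by fun_prop)]
  simp_rw [← lintegral_haarUnitary_homogeneous b hn hom j]
  have hm : Measurable (Function.uncurry fun x (U : unitary (H →L[ℂ] H)) => A (invAct U x)) := by
    have h := (measurable_invAct_apply hA).comp
      (measurable_swap (α := H) (β := unitary (H →L[ℂ] H)))
    exact h
  rw [lintegral_lintegral_swap hm.aemeasurable]
  simp_rw [lintegral_invAct_stdGaussianOf e _ hA]
  simp

/-- Given `U⁻¹ b_j`, the vector `U⁻¹ b_l` is uniform on the unit sphere of its complement. A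
Gaussian on that complement has the same direction law, and its mean squared norm is the cardinality
on the left. -/
theorem card_erase_mul_lintegral_haarUnitary [DecidableEq ι] {A : H → ℝ≥0∞} (hA : Measurable A)
    (hom : ∀ (c : ℝ) x, 0 ≤ c → A ((c : ℂ) • x) = ENNReal.ofReal c ^ 2 * A x)
    {j l : ι} (hjl : j ≠ l) :
    (Finset.univ.erase j).card *
        ∫⁻ U, A (invAct U (b j)) * A (invAct U (b l)) ∂haarUnitary H =
      ∫⁻ U, A (invAct U (b j)) *
        ∫⁻ x, A (x - inner ℂ (invAct U (b j)) x • invAct U (b j)) ∂stdGaussianOf e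
          ∂haarUnitary H := by
  have hU (U : unitary (H →L[ℂ] H)) :
      ∫⁻ x, A (x - inner ℂ (invAct U (b j)) x • invAct U (b j)) ∂stdGaussianOf e =
        ∫⁻ x, A (invAct U (x - inner ℂ (b j) x • b j)) ∂stdGaussianOf e := by
    rw [← lintegral_invAct_stdGaussianOf e U (f := fun x =>
      A (x - inner ℂ (invAct U (b j)) x • invAct U (b j))) (hA.comp (by fun_prop))]
    simp_rw [inner_invAct_invAct, map_sub, map_smul]
  have hm : Measurable fun x : H => x - inner ℂ (b j) x • b j := by fun_prop
  have hm2 : Measurable fun p : unitary (H →L[ℂ] H) × H =>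
      A (invAct p.1 (p.2 - inner ℂ (b j) p.2 • b j)) := by
    have h := (measurable_invAct_apply hA).comp
      ((measurable_id (α := unitary (H →L[ℂ] H))).prodMap hm)
    exact h
  simp_rw [hU]
  rw [← lintegral_sq_coordProj b, stdGaussianOf_eq b e]
  simp_rw [coordProj_erase_univ]
  rw [← lintegral_mul_const _ (by fun_prop)]
  have hort (x : H) : inner ℂ (b j) (x - inner ℂ (b j) x • b j) = 0 := by
    rw [inner_sub_right, inner_smul_right, b.inner_eq_one, mul_one, sub_self]
  simp_rw [← lintegral_haarUnitary_homogeneous_pair b two_ne_zero hom A hjl (hort _)]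
  have hm1 : Measurable fun U : unitary (H →L[ℂ] H) => A (invAct U (b j)) :=
    hA.comp (measurable_invAct (b j))
  have hm3 : Measurable (Function.uncurry fun x (U : unitary (H →L[ℂ] H)) =>
      A (invAct U (b j)) * A (invAct U (x - inner ℂ (b j) x • b j))) := by
    have hs : Measurable (Prod.snd : H × unitary (H →L[ℂ] H) → unitary (H →L[ℂ] H)) :=
      measurable_snd
    have h1 := hm1.comp hs
    have h2 := hm2.comp (measurable_swap (α := H) (β := unitary (H →L[ℂ] H)))
    have h := h1.mul h2
    exact h
  rw [lintegral_lintegral_swap hm3.aemeasurable]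
  refine lintegral_congr fun U => lintegral_const_mul _ ?_
  have h := hm2.comp (measurable_prodMk_left (x := U))
  exact h

/-- Each of the `d` terms has mean `m / d`. The expectation is thus exact in every dimension, and
only fluctuations remain to be bounded. -/
theorem lintegral_sum_invAct {A : H → ℝ≥0∞} (hA : Measurable A)
    (hom : ∀ (c : ℝ) x, 0 ≤ c → A ((c : ℂ) • x) = ENNReal.ofReal c ^ 2 * A x) [Nonempty ι] :
    ∫⁻ U, ∑ j, A (invAct U (b j)) ∂haarUnitary H = ∫⁻ x, A x ∂stdGaussianOf e := by
  obtain ⟨i⟩ := ‹Nonempty ι›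
  have hmA (j : ι) : Measurable fun U : unitary (H →L[ℂ] H) => A (invAct U (b j)) :=
    hA.comp (measurable_invAct (b j))
  rw [lintegral_finsetSum _ fun j _ => hmA j]
  rw [Finset.sum_congr rfl fun j _ => (lintegral_haarUnitary_homogeneous b two_ne_zero hom i
    (b j)), ← moment_mul_lintegral_haarUnitary e b hA two_ne_zero hom i, stdGaussianOf_eq e b,
    lintegral_sq_enorm]
  simp [← ofReal_norm]

/-- The second moment of `∑ j, A (U⁻¹ b_j)` exceeds the square of the first by `O(1 / dim H)`,
uniformly in `A`. -/
theorem lintegral_sq_sum_invAct_le (s : Finset κ) {A : H → ℝ≥0∞} (hA : Measurable A)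
    (hom : ∀ (c : ℝ) x, 0 ≤ c → A ((c : ℂ) • x) = ENNReal.ofReal c ^ 2 * A x)
    (hproj : ∀ x, A (coordProj e s x) = A x) (hle : ∀ x, A x ≤ ‖coordProj e s x‖ₑ ^ 2)
    [Nonempty ι] :
    Fintype.card ι * ∫⁻ U, (∑ j, A (invAct U (b j))) ^ 2 ∂haarUnitary H ≤
      Fintype.card ι * (∫⁻ x, A x ∂stdGaussianOf e) ^ 2 +
        (1 + 2 * s.card) * (s.card ^ 2 * ∫⁻ z, ‖z‖ₑ ^ 4 ∂stdComplexGaussian) := by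
  classical
  set m := ∫⁻ x, A x ∂stdGaussianOf e with hm
  set d : ℝ≥0∞ := (Fintype.card ι : ℝ≥0∞) with hd
  set k : ℝ≥0∞ := (s.card : ℝ≥0∞) with hk
  set c₄ := ∫⁻ z, ‖z‖ₑ ^ 4 ∂stdComplexGaussian with hc₄
  have hmA (j : ι) : Measurable fun U : unitary (H →L[ℂ] H) => A (invAct U (b j)) :=
    hA.comp (measurable_invAct (b j))
  have hmP (j : ι) : Measurable fun U : unitary (H →L[ℂ] H) =>
      ‖coordProj e s (invAct U (b j))‖ₑ := by
    have := measurable_invAct (b j)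
    fun_prop
  have hQ1 (j : ι) : d * ∫⁻ U, A (invAct U (b j)) ∂haarUnitary H = m := by
    rw [hm, ← moment_mul_lintegral_haarUnitary e b hA two_ne_zero hom j, stdGaussianOf_eq e b,
      lintegral_sq_enorm]
  -- A Haar unit vector has only `O(1/d)` of its squared norm in the coordinates of `s`, in the
  -- mean-square sense.
  have ht4 (j : ι) : d ^ 2 * ∫⁻ U, ‖coordProj e s (invAct U (b j))‖ₑ ^ 4 ∂haarUnitary H ≤
      k ^ 2 * c₄ := by
    refine le_trans ?_ (lintegral_pow_four_coordProj_le e s)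
    rw [← moment_mul_lintegral_haarUnitary e b (A := fun x => ‖coordProj e s x‖ₑ ^ 4)
      (by fun_prop) four_ne_zero ?_ j]
    · gcongr
      rw [stdGaussianOf_eq e b]
      exact sq_card_le_lintegral_pow_four b
    · intro c x hc
      rw [map_smul, enorm_smul, mul_pow]
      congr 2
      rw [← ofReal_norm, Complex.norm_real, Real.norm_of_nonneg hc]
  -- The `d - 1` off-diagonal terms each carry a weight `1 / (d - 1)`, so the leading part sums to
  -- `m² / d` with no loss.
  have hQ2 (j : ι) : ∑ l ∈ Finset.univ.erase j,
      ∫⁻ U, A (invAct U (b j)) * A (invAct U (b l)) ∂haarUnitary H ≤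
        m * ∫⁻ U, A (invAct U (b j)) ∂haarUnitary H +
          2 * k * ∫⁻ U, ‖coordProj e s (invAct U (b j))‖ₑ ^ 4 ∂haarUnitary H := by
    refine sum_le_of_card_mul_le fun l hl => ?_
    rw [card_erase_mul_lintegral_haarUnitary e b hA hom (Finset.ne_of_mem_erase hl).symm,
      ← lintegral_const_mul _ (hmA j), ← lintegral_const_mul _ ((hmP j).pow_const 4),
      ← lintegral_add_left ((hmA j).const_mul _)]
    refine lintegral_mono fun U => ?_
    have h1 := lintegral_sub_inner_smul_le_add e s hA hproj hle (w := invAct U (b j))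
      ((norm_invAct U _).trans (b.norm_eq_one j))
    calc _ ≤ A (invAct U (b j)) * (m + 2 * k * ‖coordProj e s (invAct U (b j))‖ₑ ^ 2) := by
          gcongr
      _ = m * A (invAct U (b j)) +
          2 * k * (A (invAct U (b j)) * ‖coordProj e s (invAct U (b j))‖ₑ ^ 2) := by ring
      _ ≤ m * A (invAct U (b j)) + 2 * k * (‖coordProj e s (invAct U (b j))‖ₑ ^ 2 *
          ‖coordProj e s (invAct U (b j))‖ₑ ^ 2) := by
          gcongr
          exact hle _
      _ = _ := by ring
  have hdiag (j : ι) : ∫⁻ U, A (invAct U (b j)) * A (invAct U (b j)) ∂haarUnitary H ≤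
      ∫⁻ U, ‖coordProj e s (invAct U (b j))‖ₑ ^ 4 ∂haarUnitary H := by
    refine lintegral_mono fun U => ?_
    calc _ ≤ ‖coordProj e s (invAct U (b j))‖ₑ ^ 2 * ‖coordProj e s (invAct U (b j))‖ₑ ^ 2 :=
          mul_le_mul' (hle _) (hle _)
      _ = _ := by ring
  have hsum : ∫⁻ U, (∑ j, A (invAct U (b j))) ^ 2 ∂haarUnitary H =
      ∑ j, ∑ l, ∫⁻ U, A (invAct U (b j)) * A (invAct U (b l)) ∂haarUnitary H := by
    simp_rw [sq, Finset.sum_mul_sum]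
    have hmm (j l : ι) : Measurable fun U : unitary (H →L[ℂ] H) =>
        A (invAct U (b j)) * A (invAct U (b l)) := (hmA j).mul (hmA l)
    rw [lintegral_finsetSum _ fun j _ => Finset.measurable_fun_sum _ fun l _ => hmm j l]
    exact Finset.sum_congr rfl fun j _ => lintegral_finsetSum _ fun l _ => hmm j l
  -- One factor `d` turns the mean of `A (U⁻¹ b_j)` into `m`; both are needed for the fourth moment.
  -- The second `d` is later absorbed by summing the `d` rows.
  have hrow (j : ι) : d * (d * ∑ l, ∫⁻ U, A (invAct U (b j)) * A (invAct U (b l)) ∂haarUnitary H) ≤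
      d * m ^ 2 + (1 + 2 * k) * (k ^ 2 * c₄) := by
    rw [← Finset.sum_erase_add _ _ (Finset.mem_univ j)]
    calc _ ≤ d * (d * ((m * ∫⁻ U, A (invAct U (b j)) ∂haarUnitary H +
          2 * k * ∫⁻ U, ‖coordProj e s (invAct U (b j))‖ₑ ^ 4 ∂haarUnitary H) +
          ∫⁻ U, ‖coordProj e s (invAct U (b j))‖ₑ ^ 4 ∂haarUnitary H)) := by
          exact mul_le_mul_right (mul_le_mul_right (add_le_add (hQ2 j) (hdiag j)) _) _
      _ = d * m * (d * ∫⁻ U, A (invAct U (b j)) ∂haarUnitary H) + (1 + 2 * k) *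
          (d ^ 2 * ∫⁻ U, ‖coordProj e s (invAct U (b j))‖ₑ ^ 4 ∂haarUnitary H) := by ring
      _ ≤ d * m * m + (1 + 2 * k) * (k ^ 2 * c₄) := by
          rw [hQ1]
          exact add_le_add le_rfl (mul_le_mul_right (ht4 j) _)
      _ = _ := by ring
  rw [hsum, Finset.mul_sum]
  refine sum_le_of_card_mul_le fun j _ => ?_
  exact hrow j

end

/-! ### Eigenvalues of density operators -/

section

variable {H : Type*} [NormedAddCommGroup H] [InnerProductSpace ℂ H] [FiniteDimensional ℂ H]
  (ρ : DensityOperator H)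

theorem DensityOperator.eigenvalue_nonneg (i : Fin (finrank ℂ H)) : 0 ≤ ρ.eigenvalue i :=
  ρ.isPositive.nonneg_eigenvalues rfl i

theorem DensityOperator.sum_eigenvalue : ∑ i, ρ.eigenvalue i = 1 := by
  have h := ρ.isPositive.isSymmetric.trace_eq_sum_eigenvalues rfl
  rw [ρ.trace_eq_one] at h
  have h2 : ((∑ i, ρ.eigenvalue i : ℝ) : ℂ) = 1 := by
    exact h.symm
  exact_mod_cast h2

theorem DensityOperator.eigenvalue_le_one (i : Fin (finrank ℂ H)) : ρ.eigenvalue i ≤ 1 :=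
  ρ.sum_eigenvalue ▸
    Finset.single_le_sum (fun j _ => ρ.eigenvalue_nonneg j) (Finset.mem_univ i)

theorem DensityOperator.op_eigenbasis (i : Fin (finrank ℂ H)) :
    ρ.op (ρ.eigenbasis i) = (ρ.eigenvalue i : ℂ) • ρ.eigenbasis i :=
  ρ.isPositive.isSymmetric.apply_eigenvectorBasis rfl i

theorem DensityOperator.sqrt_mul_sqrt_eigenvalue (i : Fin (finrank ℂ H)) :
    (√(ρ.eigenvalue i) : ℂ) * (√(ρ.eigenvalue i) : ℂ) = ρ.eigenvalue i := by
  rw [← Complex.ofReal_mul, Real.mul_self_sqrt (ρ.eigenvalue_nonneg i)]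

end

/-! ### Schmidt vectors of orthonormal systems -/

section

variable {H₁ : Type*} [NormedAddCommGroup H₁] [InnerProductSpace ℂ H₁]
variable {H₂ : Type*} [NormedAddCommGroup H₂] [InnerProductSpace ℂ H₂]

theorem partialInner_tmul (y z : H₂) (x : H₁) :
    partialInner y (x ⊗ₜ[ℂ] z) = inner ℂ y z • x := by
  simp [partialInner]

variable [FiniteDimensional ℂ H₁] (ρ : DensityOperator H₁) (φ : Fin (finrank ℂ H₁) → H₂)

theorem partialInner_schmidtMap (y : H₂) :
    partialInner y (schmidtMap ρ φ) =
      ∑ i, ((√(ρ.eigenvalue i) : ℂ) * inner ℂ y (φ i)) • ρ.eigenbasis i := by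
  simp only [schmidtMap, map_sum, map_smul, partialInner_tmul, smul_smul]

theorem schmidtMap_eq_sum_tmul :
    schmidtMap ρ φ = ∑ i, ((√(ρ.eigenvalue i) : ℂ) • ρ.eigenbasis i) ⊗ₜ[ℂ] φ i := by
  simp only [schmidtMap, TensorProduct.smul_tmul']

theorem inner_schmidtMap_tmul (m : Fin (finrank ℂ H₁)) (y : H₂) :
    inner ℂ (schmidtMap ρ φ) (ρ.eigenbasis m ⊗ₜ[ℂ] y) =
      (√(ρ.eigenvalue m) : ℂ) * inner ℂ (φ m) y := by
  rw [schmidtMap_eq_sum_tmul, sum_inner]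
  simp only [TensorProduct.inner_tmul, inner_smul_left, Complex.conj_ofReal,
    ρ.eigenbasis.inner_eq_ite]
  simp

variable {φ}

theorem norm_schmidtMap (hφ : Orthonormal ℂ φ) : ‖schmidtMap ρ φ‖ = 1 := by
  have h : inner ℂ (schmidtMap ρ φ) (schmidtMap ρ φ) = (1 : ℂ) := by
    conv_lhs => enter [3]; rw [schmidtMap_eq_sum_tmul]
    simp only [inner_sum, TensorProduct.smul_tmul, inner_smul_right,
      inner_schmidtMap_tmul, orthonormal_iff_ite.1 hφ]
    simp only [if_true, mul_one, ρ.sqrt_mul_sqrt_eigenvalue]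
    rw [← Complex.ofReal_sum, ρ.sum_eigenvalue, Complex.ofReal_one]
  have h2 : ‖schmidtMap ρ φ‖ ^ 2 = 1 :=
    (norm_sq_eq_re_inner (𝕜 := ℂ) _).trans (by rw [h]; simp)
  exact (pow_eq_one_iff_of_nonneg (norm_nonneg _) two_ne_zero).1 h2

/-- On eigenvectors of `ρ`, Parseval's identity in `H₂` and the orthonormality of `φ` leave only the
diagonal term `p_m`. -/
theorem reducedDensity_schmidtMap [FiniteDimensional ℂ H₂] (hφ : Orthonormal ℂ φ) :
    reducedDensity (schmidtMap ρ φ) = ρ.op := by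
  refine ρ.eigenbasis.toBasis.ext fun m => ?_
  rw [OrthonormalBasis.coe_toBasis, ρ.op_eigenbasis, reducedDensity, partialTrace]
  simp only [LinearMap.sum_apply, LinearMap.comp_apply, LinearMap.flip_apply,
    TensorProduct.mk_apply, ContinuousLinearMap.coe_coe, InnerProductSpace.rankOne_apply, map_smul,
    inner_schmidtMap_tmul, partialInner_schmidtMap, Finset.smul_sum, smul_smul]
  rw [Finset.sum_comm]
  have hsum (i : Fin (finrank ℂ H₁)) :
      ∑ j, ((√(ρ.eigenvalue m) : ℂ) * inner ℂ (φ m) (stdOrthonormalBasis ℂ H₂ j) *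
        ((√(ρ.eigenvalue i) : ℂ) * inner ℂ (stdOrthonormalBasis ℂ H₂ j) (φ i))) =
        if m = i then (ρ.eigenvalue m : ℂ) else 0 := by
    rw [Finset.sum_congr rfl fun j _ => mul_mul_mul_comm _ _ _ _, ← Finset.mul_sum,
      OrthonormalBasis.sum_inner_mul_inner, orthonormal_iff_ite.1 hφ]
    split_ifs with h
    · rw [h, mul_one, ρ.sqrt_mul_sqrt_eigenvalue]
    · rw [mul_zero]
  simp_rw [← Finset.sum_smul, hsum]
  simp

theorem schmidtMap_mem_statesWithReduced [FiniteDimensional ℂ H₂] (hφ : Orthonormal ℂ φ) :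
    schmidtMap ρ φ ∈ statesWithReduced (H₂ := H₂) ρ :=
  ⟨norm_schmidtMap ρ hφ, reducedDensity_schmidtMap ρ hφ⟩

theorem continuous_schmidtMap : Continuous (schmidtMap (H₂ := H₂) ρ) := by
  have h : schmidtMap (H₂ := H₂) ρ = fun φ => ∑ i, TensorProduct.mkL ℂ H₁ H₂
      ((√(ρ.eigenvalue i) : ℂ) • ρ.eigenbasis i) (φ i) := funext (schmidtMap_eq_sum_tmul ρ)
  rw [h]
  exact continuous_finsetSum _ fun i _ =>
    (TensorProduct.mkL ℂ H₁ H₂ _).continuous.comp (continuous_apply i)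

end

/-! ### Quadratically homogeneous extensions of functions on the sphere -/

section

variable {H : Type*} [NormedAddCommGroup H] [InnerProductSpace ℂ H]

open Classical in
/-- The extension `v ↦ ‖v‖² q(v / ‖v‖)` of a function on the unit sphere. -/
def homExt (q : Metric.sphere (0 : H) 1 → ℝ≥0∞) (v : H) : ℝ≥0∞ :=
  if h : v = 0 then 0 else ‖v‖ₑ ^ 2 * q (sphereProj ⟨v, h⟩)

theorem homExt_zero (q : Metric.sphere (0 : H) 1 → ℝ≥0∞) : homExt q 0 = 0 := by
  simp [homExt]

theorem homExt_of_ne_zero (q : Metric.sphere (0 : H) 1 → ℝ≥0∞) {v : H} (h : v ≠ 0) :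
    homExt q v = ‖v‖ₑ ^ 2 * q (sphereProj ⟨v, h⟩) := by
  simp [homExt, h]

theorem homExt_le {q : Metric.sphere (0 : H) 1 → ℝ≥0∞} (hq : ∀ x, q x ≤ 1) (v : H) :
    homExt q v ≤ ‖v‖ₑ ^ 2 := by
  rcases eq_or_ne v 0 with rfl | h
  · simp [homExt_zero]
  · rw [homExt_of_ne_zero q h]
    exact mul_le_of_le_one_right' (hq _)

theorem homExt_one (v : H) : homExt (fun _ => 1) v = ‖v‖ₑ ^ 2 := by
  rcases eq_or_ne v 0 with rfl | h
  · simp [homExt_zero]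
  · rw [homExt_of_ne_zero _ h, mul_one]

theorem homExt_smul (q : Metric.sphere (0 : H) 1 → ℝ≥0∞) {c : ℝ} (hc : 0 ≤ c) (v : H) :
    homExt q ((c : ℂ) • v) = ENNReal.ofReal c ^ 2 * homExt q v := by
  rcases eq_or_ne v 0 with rfl | h
  · simp [homExt_zero]
  rcases hc.eq_or_lt with rfl | hc
  · simp [homExt_zero]
  have hcv : (c : ℂ) • v ≠ 0 := smul_ne_zero (by exact_mod_cast hc.ne') h
  have hs : sphereProj ⟨(c : ℂ) • v, hcv⟩ = sphereProj ⟨v, h⟩ := by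
    apply Subtype.ext
    have hn : ‖v‖ ≠ 0 := norm_ne_zero_iff.2 h
    simp only [sphereProj, norm_smul, Complex.norm_real, Real.norm_of_nonneg hc.le, smul_smul]
    congr 1
    rw [← Complex.ofReal_mul]
    congr 1
    field_simp
  have he : ‖(c : ℂ)‖ₑ = ENNReal.ofReal c := by
    rw [← ofReal_norm, Complex.norm_real, Real.norm_of_nonneg hc.le]
  rw [homExt_of_ne_zero q h, homExt_of_ne_zero q hcv, hs, enorm_smul, mul_pow, mul_assoc, he]

variable [MeasurableSpace H] [BorelSpace H]

/-! ### Sphere integrals as integrals of homogeneous extensions -/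

theorem measurable_sphereProj : Measurable (sphereProj (H := H)) := by
  have : Continuous (sphereProj (H := H)) := by
    refine Continuous.subtype_mk ?_ _
    refine Continuous.smul (Complex.continuous_ofReal.comp ?_) continuous_subtype_val
    exact Continuous.inv₀ continuous_subtype_val.norm fun x => norm_ne_zero_iff.2 x.2
  exact this.measurable

theorem measurable_homExt {q : Metric.sphere (0 : H) 1 → ℝ≥0∞} (hq : Measurable q) :
    Measurable (homExt q) := by
  refine measurable_of_restrict_of_restrict_compl (s := {0}) (measurableSet_singleton 0) ?_ ?_
  · convert measurable_const (a := (0 : ℝ≥0∞)) using 2 with x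
    have hx : (x : H) = 0 := x.2
    rw [Set.domRestrict_apply, hx, homExt_zero]
  · have h1 : Measurable fun x : ({0}ᶜ : Set H) => ‖(x : H)‖ₑ ^ 2 := by fun_prop
    convert h1.mul (hq.comp measurable_sphereProj) using 1
    funext x
    exact homExt_of_ne_zero q x.2

/-- The weight `‖x‖²` is absorbed into `homExt`. It vanishes at the origin, so a possible atom of
`μ` there is harmless. -/
theorem lintegral_project_adjust (μ : Measure H) {q : Metric.sphere (0 : H) 1 → ℝ≥0∞}
    (hq : Measurable q) :
    ∫⁻ x, q x ∂project (adjust μ) = ∫⁻ x, homExt q x ∂μ := by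
  have hs : MeasurableSet ({0}ᶜ : Set H) := (measurableSet_singleton 0).compl
  have hE := measurable_homExt hq
  have hd : Measurable fun x : H => ENNReal.ofReal (‖x‖ ^ 2) := by fun_prop
  -- This quotient extends `q ∘ sphereProj` to all of `H`, so the integral over the subtype becomes
  -- one over a restricted measure.
  have hq' : Measurable (homExt q / fun x : H => ENNReal.ofReal (‖x‖ ^ 2) : H → ℝ≥0∞) := hE.div hd
  have hx (x : ({0}ᶜ : Set H)) :
      q (sphereProj x) = (homExt q / fun x : H => ENNReal.ofReal (‖x‖ ^ 2) : H → ℝ≥0∞) (x : H) := by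
    have hne : ‖(x : H)‖ₑ ≠ 0 := enorm_ne_zero.2 x.2
    rw [Pi.div_apply, homExt_of_ne_zero q x.2, ofReal_sq_norm,
      mul_comm, ENNReal.mul_div_cancel_right (pow_ne_zero _ hne) (by simp)]
  rw [project, lintegral_map hq measurable_sphereProj]
  simp_rw [hx]
  rw [lintegral_subtype_comap hs, adjust, restrict_withDensity hs,
    lintegral_withDensity_eq_lintegral_mul _ hd hq',
    ← lintegral_indicator hs]
  refine lintegral_congr fun x => ?_
  rcases eq_or_ne x 0 with rfl | h
  · simp [homExt_zero]
  · have hne : ‖x‖ₑ ≠ 0 := enorm_ne_zero.2 h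
    rw [Set.indicator_of_mem (by simpa using h), Pi.mul_apply, Pi.div_apply, ofReal_sq_norm,
      ENNReal.mul_div_cancel (pow_ne_zero _ hne) (by simp)]

theorem lintegral_GAP [FiniteDimensional ℂ H] (ρ : DensityOperator H)
    {q : Metric.sphere (0 : H) 1 → ℝ≥0∞} (hq : Measurable q) :
    ∫⁻ x, q x ∂GAP ρ = ∫⁻ x, homExt q x ∂gaussian ρ :=
  lintegral_project_adjust _ hq

theorem lintegral_conditionalLaw {H₂ : Type*} [NormedAddCommGroup H₂] [InnerProductSpace ℂ H₂]
    {ι : Type*} [Fintype ι] (ψ : H ⊗[ℂ] H₂) (b : OrthonormalBasis ι ℂ H₂)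
    {q : Metric.sphere (0 : H) 1 → ℝ≥0∞} (hq : Measurable q) :
    ∫⁻ x, q x ∂conditionalLaw ψ b = ∑ j, homExt q (partialInner (b j) ψ) := by
  rw [conditionalLaw, lintegral_finsetSum_measure]
  refine Finset.sum_congr rfl fun j _ => ?_
  split_ifs with h
  · simp [h, homExt_zero]
  · rw [lintegral_smul_measure, lintegral_dirac' _ hq, homExt_of_ne_zero q h, ofReal_sq_norm,
      smul_eq_mul]

end

/-! ### The conditional wave function in terms of a random unit vector -/

/-- Conjugation appears because `condVec` contains `⟨w, e_i⟩`, the conjugate of a coordinate of `w`.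
-/
theorem map_conj_stdComplexGaussian :
    stdComplexGaussian.map (starRingEnd ℂ) = stdComplexGaussian := by
  have hn : (gaussianReal 0 (1 / 2)).map (fun x => -x) = gaussianReal 0 (1 / 2) := by
    rw [gaussianReal_map_neg, neg_zero]
  have hp : ((gaussianReal 0 (1 / 2)).prod (gaussianReal 0 (1 / 2))).map
      (Prod.map id fun x : ℝ => -x) = (gaussianReal 0 (1 / 2)).prod (gaussianReal 0 (1 / 2)) := by
    rw [← Measure.map_prod_map _ _ measurable_id measurable_neg, hn, Measure.map_id]
  conv_rhs => rw [stdComplexGaussian, ← hp]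
  rw [stdComplexGaussian, Measure.map_map (by fun_prop) measurable_complex_mk,
    Measure.map_map measurable_complex_mk (by fun_prop)]
  rfl

theorem map_conj_comp_pi_stdComplexGaussian {ι κ : Type*} [Fintype ι] [Fintype κ] {g : ι → κ}
    (hg : g.Injective) :
    (Measure.pi fun _ : κ => stdComplexGaussian).map (fun z i => starRingEnd ℂ (z (g i))) =
      Measure.pi fun _ : ι => stdComplexGaussian := by
  have hc : Measurable (starRingEnd ℂ) := Complex.continuous_conj.measurable
  have h := (iIndepFun_pi (μ := fun _ : κ => stdComplexGaussian) (X := fun _ => starRingEnd ℂ)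
    fun _ => hc.aemeasurable).precomp hg
  have hm (i : ι) : AEMeasurable (fun z : κ → ℂ => starRingEnd ℂ (z (g i)))
      (Measure.pi fun _ : κ => stdComplexGaussian) :=
    (hc.comp (measurable_pi_apply (g i))).aemeasurable
  refine ((iIndepFun_iff_map_fun_eq_pi_map hm).1 h).trans ?_
  congr 1
  funext i
  rw [← Function.comp_def (starRingEnd ℂ), ← Measure.map_map hc (measurable_pi_apply _),
    (measurePreserving_eval (fun _ : κ => stdComplexGaussian) (g i)).map_eq,
    map_conj_stdComplexGaussian]

section

variable {H₁ : Type*} [NormedAddCommGroup H₁] [InnerProductSpace ℂ H₁] [FiniteDimensional ℂ H₁]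
variable {H₂ : Type*} [NormedAddCommGroup H₂] [InnerProductSpace ℂ H₂]
variable {κ : Type*} [Fintype κ] (e : OrthonormalBasis κ ℂ H₂) (g : Fin (finrank ℂ H₁) ↪ κ)
  (ρ : DensityOperator H₁)

/-- The vector `∑ i, √p_i ⟨w, e_{g i}⟩ χ_i`: the conditional wave function, as a function of
`w = U⁻¹ b_j`. -/
def condVec (w : H₂) : H₁ :=
  ∑ i, ((√(ρ.eigenvalue i) : ℂ) * inner ℂ w (e (g i))) • ρ.eigenbasis i

theorem condVec_smul (c : ℝ) (w : H₂) : condVec e g ρ ((c : ℂ) • w) = (c : ℂ) • condVec e g ρ w := by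
  simp only [condVec, inner_smul_left, Complex.conj_ofReal, Finset.smul_sum, smul_smul]
  exact Finset.sum_congr rfl fun i _ => by rw [mul_left_comm]

theorem condVec_coordProj (w : H₂) :
    condVec e g ρ (coordProj e (Finset.univ.map g) w) = condVec e g ρ w := by
  classical
  unfold condVec
  refine Finset.sum_congr rfl fun i _ => ?_
  rw [← inner_conj_symm, inner_basis_coordProj, if_pos (by simp), inner_conj_symm]

theorem norm_sq_condVec (w : H₂) :
    ‖condVec e g ρ w‖ ^ 2 = ∑ i, ρ.eigenvalue i * ‖inner ℂ w (e (g i))‖ ^ 2 := by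
  rw [← ρ.eigenbasis.sum_sq_norm_inner_right]
  refine Finset.sum_congr rfl fun i _ => ?_
  rw [condVec, ρ.eigenbasis.orthonormal.inner_right_fintype, norm_mul, mul_pow, Complex.norm_real,
    Real.norm_eq_abs, sq_abs, Real.sq_sqrt (ρ.eigenvalue_nonneg i)]

theorem enorm_sq_condVec_le (w : H₂) :
    ‖condVec e g ρ w‖ₑ ^ 2 ≤ ‖coordProj e (Finset.univ.map g) w‖ₑ ^ 2 := by
  rw [← ofReal_sq_norm, ← ofReal_sq_norm]
  apply ENNReal.ofReal_le_ofReal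
  rw [norm_sq_condVec, norm_sq_coordProj, Finset.sum_map]
  refine Finset.sum_le_sum fun i _ => ?_
  rw [← norm_inner_symm w]
  exact mul_le_of_le_one_left (by positivity) (ρ.eigenvalue_le_one i)

/-- Parseval in `b` for each `e (g i)`, then the trace condition on `ρ`. This is the total mass of
the conditional law. -/
theorem sum_enorm_sq_condVec {ι : Type*} [Fintype ι] (b : OrthonormalBasis ι ℂ H₂) :
    ∑ j, ‖condVec e g ρ (b j)‖ₑ ^ 2 = 1 := by
  simp_rw [← ofReal_sq_norm]
  rw [← ENNReal.ofReal_sum_of_nonneg fun j _ => by positivity]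
  simp_rw [norm_sq_condVec]
  rw [Finset.sum_comm]
  simp_rw [← Finset.mul_sum, b.sum_sq_norm_inner_right, e.norm_eq_one]
  simp [ρ.sum_eigenvalue]

variable [MeasurableSpace H₁] [BorelSpace H₁] [FiniteDimensional ℂ H₂] [MeasurableSpace H₂]
  [BorelSpace H₂]

theorem measurable_condVec : Measurable (condVec e g ρ) := by
  have : Continuous (condVec e g ρ) := by
    unfold condVec
    fun_prop
  exact this.measurable

/-- Realises `G(ρ)` on the large space, so that GAP and the conditional law average the same
function on `H₂`. -/
theorem lintegral_gaussian_eq_condVec {F : H₁ → ℝ≥0∞} (hF : Measurable F) :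
    ∫⁻ x, F x ∂gaussian ρ = ∫⁻ x, F (condVec e g ρ x) ∂stdGaussianOf e := by
  have hm : Measurable fun z : Fin (finrank ℂ H₁) → ℂ =>
      ∑ i, ((√(ρ.eigenvalue i) : ℂ) * z i) • ρ.eigenbasis i :=
    (by fun_prop : Continuous fun z : Fin (finrank ℂ H₁) → ℂ =>
      ∑ i, ((√(ρ.eigenvalue i) : ℂ) * z i) • ρ.eigenbasis i).measurable
  have hr : Measurable fun (z : κ → ℂ) (i : Fin (finrank ℂ H₁)) => starRingEnd ℂ (z (g i)) :=
    (by fun_prop : Continuous fun (z : κ → ℂ) (i : Fin (finrank ℂ H₁)) =>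
      starRingEnd ℂ (z (g i))).measurable
  have hFm : Measurable fun z : Fin (finrank ℂ H₁) → ℂ =>
      F (∑ i, ((√(ρ.eigenvalue i) : ℂ) * z i) • ρ.eigenbasis i) := hF.comp hm
  rw [gaussian, lintegral_map hF hm, ← map_conj_comp_pi_stdComplexGaussian g.injective,
    lintegral_map hFm hr,
    lintegral_stdGaussianOf e (f := fun x => F (condVec e g ρ x))
      (hF.comp (measurable_condVec e g ρ))]
  refine lintegral_congr fun z => ?_
  simp only [condVec, e.orthonormal.inner_left_fintype]

end

/-! ### Concentration -/

section

variable {H : Type*} [NormedAddCommGroup H] [InnerProductSpace ℂ H] [FiniteDimensional ℂ H]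
  [CompleteSpace H] [MeasurableSpace H] [BorelSpace H] {ι κ : Type*} [Fintype ι] [Fintype κ]

/-- The constant in the variance bound, in terms of the number `k` of coordinates. -/
def varianceConst (k : ℕ) : ℝ :=
  (1 + 2 * k) * (k ^ 2 * (∫⁻ z, ‖z‖ₑ ^ 4 ∂stdComplexGaussian).toReal)

theorem varianceConst_nonneg (k : ℕ) : 0 ≤ varianceConst k := by
  unfold varianceConst
  positivity

theorem ofReal_varianceConst (k : ℕ) : ENNReal.ofReal (varianceConst k) =
    (1 + 2 * k) * (k ^ 2 * ∫⁻ z, ‖z‖ₑ ^ 4 ∂stdComplexGaussian) := by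
  have hc := lintegral_enorm_pow_four_stdComplexGaussian_lt_top.ne
  have h : varianceConst k =
      ((1 + 2 * k) * (k ^ 2 * ∫⁻ z, ‖z‖ₑ ^ 4 ∂stdComplexGaussian)).toReal := by
    rw [varianceConst, ENNReal.toReal_mul, ENNReal.toReal_mul, ENNReal.toReal_add (by simp)
      (ENNReal.mul_ne_top (by simp) (by simp))]
    simp
  rw [h, ENNReal.ofReal_toReal]
  exact ENNReal.mul_ne_top (by simp [ENNReal.mul_eq_top]) (ENNReal.mul_ne_top (by simp) hc)

/-- Chebyshev's inequality: since the mean is exactly `m`, the term `m²` cancels in the variance and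
leaves `varianceConst / d`. -/
theorem haarUnitary_deviation_le (e : OrthonormalBasis κ ℂ H) (b : OrthonormalBasis ι ℂ H)
    (s : Finset κ) {A : H → ℝ≥0∞} (hA : Measurable A)
    (hom : ∀ (c : ℝ) x, 0 ≤ c → A ((c : ℂ) • x) = ENNReal.ofReal c ^ 2 * A x)
    (hproj : ∀ x, A (coordProj e s x) = A x) (hle : ∀ x, A x ≤ ‖coordProj e s x‖ₑ ^ 2)
    (hone : ∀ U : unitary (H →L[ℂ] H), ∑ j, A (invAct U (b j)) ≤ 1) [Nonempty ι] {c : ℝ}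
    (hc : 0 < c) :
    haarUnitary H {U | c ≤ |(∑ j, A (invAct U (b j))).toReal -
        (∫⁻ x, A x ∂stdGaussianOf e).toReal|} ≤
      ENNReal.ofReal (varianceConst s.card / (Fintype.card ι * c ^ 2)) := by
  set X : unitary (H →L[ℂ] H) → ℝ≥0∞ := fun U => ∑ j, A (invAct U (b j)) with hX
  set m := ∫⁻ x, A x ∂stdGaussianOf e with hm
  set C := varianceConst s.card
  have hd : (0 : ℝ) < Fintype.card ι := by exact_mod_cast Fintype.card_pos
  have hXm : Measurable X :=
    Finset.measurable_fun_sum _ fun j _ => hA.comp (measurable_invAct (b j))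
  have hXt (U : unitary (H →L[ℂ] H)) : X U ≠ ∞ := ((hone U).trans_lt ENNReal.one_lt_top).ne
  have hEX : ∫⁻ U, X U ∂haarUnitary H = m := lintegral_sum_invAct e b hA hom
  have hEX2 := lintegral_sq_sum_invAct_le e b s hA hom hproj hle
  rw [← ofReal_varianceConst] at hEX2
  have hX2t : ∫⁻ U, X U ^ 2 ∂haarUnitary H ≤ 1 := by
    calc _ ≤ ∫⁻ _, 1 ∂haarUnitary H := lintegral_mono fun U => pow_le_one' (hone U) 2
      _ = 1 := by simp
  have hmt : m ≤ 1 := by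
    rw [← hEX]
    calc _ ≤ ∫⁻ _, 1 ∂haarUnitary H := lintegral_mono fun U => hone U
      _ = 1 := by simp
  set Y : unitary (H →L[ℂ] H) → ℝ := fun U => (X U).toReal with hY
  have hYm : Measurable Y := hXm.ennreal_toReal
  have hY1 (U : unitary (H →L[ℂ] H)) : Y U ≤ 1 := by
    have := ENNReal.toReal_mono ENNReal.one_ne_top (hone U)
    simpa using this
  have hYL : MemLp Y 2 (haarUnitary H) := by
    refine MemLp.of_bound hYm.aestronglyMeasurable 1 (Filter.Eventually.of_forall fun U => ?_)
    rw [Real.norm_of_nonneg ENNReal.toReal_nonneg]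
    exact hY1 U
  have hEY : ∫ U, Y U ∂haarUnitary H = m.toReal := by
    rw [← hEX, integral_toReal hXm.aemeasurable
      (Filter.Eventually.of_forall fun U => (hXt U).lt_top)]
  have hEY2 : ∫ U, Y U ^ 2 ∂haarUnitary H = (∫⁻ U, X U ^ 2 ∂haarUnitary H).toReal := by
    rw [← integral_toReal (hXm.pow_const 2).aemeasurable
      (Filter.Eventually.of_forall fun U => ENNReal.pow_lt_top (hXt U).lt_top)]
    simp [hY]
  have hvar : variance Y (haarUnitary H) ≤ C / Fintype.card ι := by
    rw [variance_eq_sub hYL]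
    simp only [Pi.pow_apply]
    rw [hEY, hEY2, le_div_iff₀ hd]
    have h := ENNReal.toReal_mono (ENNReal.add_ne_top.2 ⟨ENNReal.mul_ne_top (by simp)
      (ENNReal.pow_ne_top (hmt.trans_lt ENNReal.one_lt_top).ne), ENNReal.ofReal_ne_top⟩) hEX2
    rw [ENNReal.toReal_add (ENNReal.mul_ne_top (by simp)
      (ENNReal.pow_ne_top (hmt.trans_lt ENNReal.one_lt_top).ne)) ENNReal.ofReal_ne_top,
      ENNReal.toReal_mul, ENNReal.toReal_mul, ENNReal.toReal_pow,
      ENNReal.toReal_ofReal (varianceConst_nonneg _), ENNReal.toReal_natCast] at h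
    linarith
  have hcheb := meas_ge_le_variance_div_sq hYL hc
  rw [hEY] at hcheb
  refine hcheb.trans (ENNReal.ofReal_le_ofReal ?_)
  rw [← div_div]
  gcongr

end

/-! ### Main theorem -/

section

variable {H₁ : Type*} [NormedAddCommGroup H₁] [InnerProductSpace ℂ H₁] [FiniteDimensional ℂ H₁]
  [MeasurableSpace H₁] [BorelSpace H₁]
variable {H₂ : Type*} [NormedAddCommGroup H₂] [InnerProductSpace ℂ H₂] [FiniteDimensional ℂ H₂]
  [CompleteSpace H₂] [MeasurableSpace H₂] [BorelSpace H₂]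

/-! ### The uniform distribution as an image of Haar measure, and normalisation of the test function
-/

theorem continuous_schmidtMap_unitary (hd : finrank ℂ H₁ ≤ finrank ℂ H₂) (ρ : DensityOperator H₁) :
    Continuous fun U : unitary (H₂ →L[ℂ] H₂) => schmidtMap ρ fun i =>
      (U : H₂ →L[ℂ] H₂) (stdOrthonormalBasis ℂ H₂ (Fin.castLE hd i)) :=
  (continuous_schmidtMap ρ).comp <| continuous_pi fun _ =>
    continuous_subtype_val.clm_apply continuous_const

theorem uniformStates_eq_map (hd : finrank ℂ H₁ ≤ finrank ℂ H₂) (ρ : DensityOperator H₁) :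
    uniformStates hd ρ = (haarUnitary H₂).map fun U : unitary (H₂ →L[ℂ] H₂) => schmidtMap ρ fun i =>
      (U : H₂ →L[ℂ] H₂) (stdOrthonormalBasis ℂ H₂ (Fin.castLE hd i)) := by
  have := FiniteDimensional.proper ℂ H₂
  have : SecondCountableTopology H₂ := inferInstance
  have h1 : Measurable fun (U : unitary (H₂ →L[ℂ] H₂)) (i : Fin (finrank ℂ H₂)) =>
      (U : H₂ →L[ℂ] H₂) (stdOrthonormalBasis ℂ H₂ i) :=
    measurable_pi_iff.2 fun i =>
      (continuous_subtype_val.clm_apply continuous_const).measurable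
  have h2 : Measurable fun (φ : Fin (finrank ℂ H₂) → H₂) (i : Fin (finrank ℂ H₁)) =>
      φ (Fin.castLE hd i) := measurable_pi_iff.2 fun i => measurable_pi_apply _
  have h3 : Measurable (schmidtMap (H₂ := H₂) ρ) := (continuous_schmidtMap ρ).measurable
  rw [uniformStates, uniformONS, uniformONB, Measure.map_map h2 h1, Measure.map_map h3 (h2.comp h1)]
  rfl

instance isProbabilityMeasure_uniformStates (hd : finrank ℂ H₁ ≤ finrank ℂ H₂)
    (ρ : DensityOperator H₁) : IsProbabilityMeasure (uniformStates (H₂ := H₂) hd ρ) := by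
  rw [uniformStates_eq_map]
  exact Measure.isProbabilityMeasure_map (continuous_schmidtMap_unitary hd ρ).measurable.aemeasurable

/-- An affine change of the test function turns a deviation in terms of `f` into one in terms of a
function with values in `[0, 1]`. -/
theorem integral_sub_integral_eq {α : Type*} [MeasurableSpace α] (μ ν : Measure α)
    [IsProbabilityMeasure μ] [IsProbabilityMeasure ν] {f : α → ℝ} (hf : Measurable f) {S : ℝ}
    (hS : 0 < S) (hfS : ∀ x, |f x| ≤ S) :
    ∫ x, f x ∂μ - ∫ x, f x ∂ν =
      2 * S * ((∫⁻ x, ENNReal.ofReal ((f x + S) / (2 * S)) ∂μ).toReal -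
        (∫⁻ x, ENNReal.ofReal ((f x + S) / (2 * S)) ∂ν).toReal) := by
  have key (μ : Measure α) [IsProbabilityMeasure μ] :
      (∫⁻ x, ENNReal.ofReal ((f x + S) / (2 * S)) ∂μ).toReal = (∫ x, f x ∂μ + S) / (2 * S) := by
    have hi : Integrable f μ := Integrable.of_bound hf.aestronglyMeasurable S
      (Filter.Eventually.of_forall hfS)
    rw [← integral_eq_lintegral_of_nonneg_ae, integral_div, integral_add hi (integrable_const S)]
    · simp
    · refine Filter.Eventually.of_forall fun x => ?_
      have := (abs_le.1 (hfS x)).1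
      simp only [Pi.zero_apply]
      exact div_nonneg (by linarith) (by linarith)
    · exact (Measurable.div_const (hf.add_const S) _).aestronglyMeasurable
  rw [key μ, key ν]
  field_simp
  ring

theorem isProbabilityMeasure_of_lintegral_one {α : Type*} [MeasurableSpace α] {μ : Measure α}
    (h : ∫⁻ _, 1 ∂μ = 1) : IsProbabilityMeasure μ :=
  ⟨by simpa using h⟩

end

end GAPTypicality

end

open GAPTypicality in
theorem theorem1 (ε δ : ℝ) (hε0 : 0 < ε) (hε1 : ε < 1) (hδ0 : 0 < δ) (hδ1 : δ < 1) (d₁ : ℕ) :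
    ∃ D₂ : ℝ, 0 < D₂ ∧ ∀ d₂ : ℕ, D₂ < (d₂ : ℝ) →
      ∀ (H₁ : Type*) [NormedAddCommGroup H₁] [InnerProductSpace ℂ H₁] [FiniteDimensional ℂ H₁]
        [MeasurableSpace H₁] [BorelSpace H₁]
        (H₂ : Type*) [NormedAddCommGroup H₂] [InnerProductSpace ℂ H₂] [FiniteDimensional ℂ H₂]
        [CompleteSpace H₂] [MeasurableSpace H₂] [BorelSpace H₂],
        Module.finrank ℂ H₁ = d₁ → Module.finrank ℂ H₂ = d₂ →
      ∀ (hd : Module.finrank ℂ H₁ < Module.finrank ℂ H₂)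
        (b : OrthonormalBasis (Fin d₂) ℂ H₂)
        (ρ₁ : GAPTypicality.DensityOperator H₁)
        (f : Metric.sphere (0 : H₁) 1 → ℝ), Measurable f → (∃ C : ℝ, ∀ x, |f x| ≤ C) → f ≠ 0 →
        1 - δ ≤ (GAPTypicality.uniformStates (H₂ := H₂) hd.le ρ₁).real
          {ψ | ψ ∈ GAPTypicality.statesWithReduced ρ₁ ∧
            |∫ x, f x ∂(GAPTypicality.conditionalLaw ψ b) - ∫ x, f x ∂(GAPTypicality.GAP ρ₁)|
              < ε * ⨆ x, |f x|} := by
  have hC := varianceConst_nonneg d₁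
  -- Solves `varianceConst d₁ / (d₂ (ε/2)²) ≤ δ` for `d₂`. The tolerance is `ε / 2` because passing
  -- from `f` to `q` divides deviations by `2 S`; the `+ 1` ensures positivity when the variance
  -- constant vanishes.
  refine ⟨varianceConst d₁ / (δ * (ε / 2) ^ 2) + 1, by positivity, ?_⟩
  intro d₂ hD H₁ _ _ _ _ _ H₂ _ _ _ _ _ _ h₁ h₂ hd b ρ f hf ⟨C, hfC⟩ hf0
  set S := ⨆ x, |f x| with hS
  have hfS (x : Metric.sphere (0 : H₁) 1) : |f x| ≤ S :=
    le_ciSup (f := fun x => |f x|) ⟨C, Set.forall_mem_range.2 hfC⟩ x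
  have hSpos : 0 < S := by
    obtain ⟨x, hx⟩ := Function.ne_iff.1 hf0
    exact (abs_pos.2 hx).trans_le (hfS x)
  have : Nonempty (Fin d₂) := ⟨⟨0, by omega⟩⟩
  set q : Metric.sphere (0 : H₁) 1 → ℝ≥0∞ := fun x => ENNReal.ofReal ((f x + S) / (2 * S)) with hq
  have hqm : Measurable q := ((hf.add_const S).div_const _).ennreal_ofReal
  have hq1 (x : Metric.sphere (0 : H₁) 1) : q x ≤ 1 := by
    rw [hq, ← ENNReal.ofReal_one]
    apply ENNReal.ofReal_le_ofReal
    rw [div_le_one (by linarith)]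
    linarith [(abs_le.1 (hfS x)).2]
  set e := stdOrthonormalBasis ℂ H₂
  set g := Fin.castLEEmb hd.le
  set K := condVec e g ρ with hK
  have hKm : Measurable K := measurable_condVec e g ρ
  set φ : unitary (H₂ →L[ℂ] H₂) → Fin (finrank ℂ H₁) → H₂ :=
    fun U i => (U : H₂ →L[ℂ] H₂) (e (Fin.castLE hd.le i)) with hφ
  have hort (U : unitary (H₂ →L[ℂ] H₂)) : Orthonormal ℂ (φ U) := by
    refine orthonormal_iff_ite.2 fun i j => ?_
    simp [hφ, inner_apply_apply, e.inner_eq_ite]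
  have hpK (U : unitary (H₂ →L[ℂ] H₂)) (y : H₂) :
      partialInner y (schmidtMap ρ (φ U)) = K (invAct U y) := by
    rw [partialInner_schmidtMap, hK, condVec]
    simp_rw [inner_invAct_left]
    rfl
  -- The vectors `U⁻¹ b_j` again form an orthonormal basis.
  have hbU (U : unitary (H₂ →L[ℂ] H₂)) : ∑ j, ‖K (invAct U (b j))‖ₑ ^ 2 = 1 := by
    have hon : Orthonormal ℂ fun j => invAct U (b j) := by
      refine orthonormal_iff_ite.2 fun i j => ?_
      rw [inner_invAct_invAct, b.inner_eq_ite]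
    obtain ⟨b', hb'⟩ := Orthonormal.exists_orthonormalBasis_extension_of_card_eq
      (finrank_eq_card_basis b.toBasis) (v := fun j => invAct U (b j)) (s := Set.univ)
      (hon.comp _ Subtype.val_injective)
    rw [← sum_enorm_sq_condVec e g ρ b']
    exact Finset.sum_congr rfl fun j _ => by rw [hb' j (Set.mem_univ j)]
  have hom (r : Metric.sphere (0 : H₁) 1 → ℝ≥0∞) (c : ℝ) (x : H₂) (hc : 0 ≤ c) :
      homExt r (K ((c : ℂ) • x)) = ENNReal.ofReal c ^ 2 * homExt r (K x) := by
    rw [hK, condVec_smul, homExt_smul r hc]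
  have hlaw (U : unitary (H₂ →L[ℂ] H₂)) :
      IsProbabilityMeasure (conditionalLaw (schmidtMap ρ (φ U)) b) := by
    refine isProbabilityMeasure_of_lintegral_one ?_
    rw [lintegral_conditionalLaw _ b measurable_const]
    exact (Finset.sum_congr rfl fun j _ => by rw [homExt_one, hpK]).trans (hbU U)
  have hGAP : IsProbabilityMeasure (GAP ρ) := by
    refine isProbabilityMeasure_of_lintegral_one ?_
    have hm1 := measurable_homExt (H := H₁) (q := fun _ => 1) measurable_const
    rw [lintegral_GAP ρ measurable_const, lintegral_gaussian_eq_condVec e g ρ hm1]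
    -- The exact mean formula with test function `1`: the Gaussian integral is a Haar average of
    -- sums all equal to one.
    refine (lintegral_sum_invAct e b (hm1.comp hKm) (hom _)).symm.trans ?_
    simp only [Function.comp_apply, homExt_one, hbU]
    simp
  have hqK (U : unitary (H₂ →L[ℂ] H₂)) :
      ∫⁻ x, q x ∂conditionalLaw (schmidtMap ρ (φ U)) b = ∑ j, homExt q (K (invAct U (b j))) := by
    simp_rw [lintegral_conditionalLaw _ b hqm, hpK]
  have hqG : ∫⁻ x, q x ∂GAP ρ = ∫⁻ x, homExt q (K x) ∂stdGaussianOf e := by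
    rw [lintegral_GAP ρ hqm, lintegral_gaussian_eq_condVec e g ρ (measurable_homExt hqm)]
  have hdev := haarUnitary_deviation_le e b (Finset.univ.map g) (A := fun x => homExt q (K x))
    ((measurable_homExt hqm).comp hKm) (hom q)
    (fun x => by rw [hK, condVec_coordProj])
    (fun x => (homExt_le hq1 _).trans (enorm_sq_condVec_le e g ρ x))
    (fun U => (Finset.sum_le_sum fun j _ => homExt_le hq1 _).trans (hbU U).le)
    (c := ε / 2) (by linarith)
  set B : Set (unitary (H₂ →L[ℂ] H₂)) := {U | ε / 2 ≤
    |(∑ j, homExt q (K (invAct U (b j)))).toReal -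
      (∫⁻ x, homExt q (K x) ∂stdGaussianOf e).toReal|} with hB
  have hBδ : haarUnitary H₂ B ≤ ENNReal.ofReal δ := by
    refine hdev.trans (ENNReal.ofReal_le_ofReal ?_)
    rw [Finset.card_map, Finset.card_univ, Fintype.card_fin, Fintype.card_fin, h₁]
    have hd2 : (0 : ℝ) < d₂ := lt_trans (by positivity) hD
    rw [div_le_iff₀ (by positivity)]
    have h := (div_le_iff₀ (by positivity)).1 (show varianceConst d₁ / (δ * (ε / 2) ^ 2) ≤ d₂ by
      linarith)
    linarith
  have hBm : MeasurableSet B := by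
    have hX (j : Fin d₂) : Measurable fun U : unitary (H₂ →L[ℂ] H₂) =>
        homExt q (K (invAct U (b j))) :=
      ((measurable_homExt hqm).comp hKm).comp (measurable_invAct (b j))
    have hX' : Measurable fun U : unitary (H₂ →L[ℂ] H₂) =>
        (∑ j, homExt q (K (invAct U (b j)))).toReal :=
      (Finset.measurable_fun_sum _ fun j _ => hX j).ennreal_toReal
    exact measurableSet_le measurable_const (hX'.sub_const _).abs
  rw [Measure.real, ← ENNReal.ofReal_le_iff_le_toReal (measure_ne_top _ _)]
  rw [uniformStates_eq_map]
  -- This inequality for image measures holds for arbitrary sets, so measurability of the event in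
  -- `H₁ ⊗ H₂` is not needed.
  refine le_trans ?_
    (Measure.le_map_apply (continuous_schmidtMap_unitary hd.le ρ).measurable.aemeasurable _)
  refine le_trans ?_ (measure_mono (s := Bᶜ) ?_)
  · rw [prob_compl_eq_one_sub hBm, ENNReal.ofReal_sub _ hδ0.le, ENNReal.ofReal_one]
    exact tsub_le_tsub_left hBδ 1
  · intro U hU
    refine ⟨schmidtMap_mem_statesWithReduced ρ (hort U), ?_⟩
    rw [hB, Set.mem_compl_iff, Set.mem_ofPred_eq, not_le] at hU
    have := hlaw U
    change |∫ x, f x ∂conditionalLaw (schmidtMap ρ (φ U)) b - ∫ x, f x ∂GAP ρ| < ε * S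
    rw [integral_sub_integral_eq _ _ hf hSpos hfS, hqK U, hqG, abs_mul,
      abs_of_pos (by positivity)]
    -- Outside `B` the deviation is `2 S` times a number below `ε / 2`.
    nlinarith
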